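/- **Lemma.** Let $(M,g_{ab})$ be a smooth four-dimensional spacetime with metric of signature $(+,-,-,-)$ and a spinor structure, i.e. a rank-two complex vector bundle $S$ of spinors with spin metric $\epsilon_{AB}$ such that $g_{ab}=\epsilon_{AB}\bar\epsilon_{A'B'}$, and let $\nabla_{AA'}$ be the (torsion-free, $\epsilon$-preserving) spin connection, which induces the Levi-Civita connection of $g$. Indices are raised and lowered by $\kappa^A=\epsilon^{AB}\kappa_B$, $\kappa_B=\kappa^A\epsilon_{AB}$, and all fields are smooth. Let $\kappa_{AB}=\kappa_{(AB)}$ be a Killing spinor, $\nabla_{(A|A'|}\kappa_{BC)}=0$, with $\kappa_{CD}\kappa^{CD}\neq 0$ everywhere, and let $\phi_{AB}=\phi_{(AB)}$ be a solution of the source-free Maxwell equation $\nabla^{B}{}_{A'}\phi_{AB}=0$. Define $$U_{AA'}=-\tfrac12\nabla_{AA'}\log(-\kappa_{CD}\kappa^{CD}),\qquad \Upsilon=\kappa^{AB}\phi_{AB},\qquad \Theta_{AB}=-2\kappa_{(A}{}^{C}\phi_{B)C},$$ $$\beta_{AA'}=\nabla^{B}{}_{A'}\Theta_{AB}+U^{B}{}_{A'}\Theta_{AB},$$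 where $\nabla\log f$ means $f^{-1}\nabla f$ (which is independent of the branch of the logarithm). Then $$\beta_{AA'}=-U_{AA'}\Upsilon+\nabla_{AA'}\Upsilon,$$ $$\nabla^{AA'}\beta_{AA'}=-U^{AA'}\beta_{AA'},\qquad \nabla_{(A}{}^{A'}\beta_{B)A'}=U_{(A}{}^{A'}\beta_{B)A'},\qquad \nabla^{A}{}_{(A'}\beta_{|A|B')}=U^{A}{}_{(A'}\beta_{|A|B')}.$$ -/

import Mathlib

open Bundle FiberBundle
open scoped Manifold ContDiff ComplexConjugate

noncomputable section

namespace KillingSpinorMaxwell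

/-- The model space of a four-dimensional spacetime. -/
abbrev R4 : Type := EuclideanSpace ℝ (Fin 4)

/-- The model fibre of the bundle of (unprimed) spinors. -/
abbrev C2 : Type := EuclideanSpace ℂ (Fin 2)

section Lorentz

/-- The vector field `X` is smooth at `x`. -/
abbrev VecSmoothAt {M : Type*} [TopologicalSpace M] [ChartedSpace R4 M]
    [IsManifold (𝓡 4) ∞ M] (X : ∀ y : M, TangentSpace (𝓡 4) y) (x : M) : Prop :=
  ContMDiffAt (𝓡 4) ((𝓡 4).prod 𝓘(ℝ, R4)) ∞
    (fun y => TotalSpace.mk' R4 (E := (TangentSpace (𝓡 4) : M → Type _)) y (X y)) x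

/-- The vector field `X` is differentiable at `x`. -/
abbrev VecDiffAt {M : Type*} [TopologicalSpace M] [ChartedSpace R4 M]
    [IsManifold (𝓡 4) ∞ M] (X : ∀ y : M, TangentSpace (𝓡 4) y) (x : M) : Prop :=
  MDifferentiableAt (𝓡 4) ((𝓡 4).prod 𝓘(ℝ, R4))
    (fun y => TotalSpace.mk' R4 (E := (TangentSpace (𝓡 4) : M → Type _)) y (X y)) x

/-- The section `s` of a bundle with model fibre `C2` is smooth at `x`. -/
abbrev SpinSmoothAt {M : Type*} [TopologicalSpace M] [ChartedSpace R4 M]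
    {S : M → Type*} [TopologicalSpace (TotalSpace C2 S)] [∀ x, TopologicalSpace (S x)]
    [FiberBundle C2 S] (s : ∀ y : M, S y) (x : M) : Prop :=
  ContMDiffAt (𝓡 4) ((𝓡 4).prod 𝓘(ℝ, C2)) ∞ (fun y => TotalSpace.mk' C2 y (s y)) x

/-- The section `s` of a bundle with model fibre `C2` is differentiable at `x`. -/
abbrev SpinDiffAt {M : Type*} [TopologicalSpace M] [ChartedSpace R4 M]
    {S : M → Type*} [TopologicalSpace (TotalSpace C2 S)] [∀ x, TopologicalSpace (S x)]
    [FiberBundle C2 S] (s : ∀ y : M, S y) (x : M) : Prop :=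
  MDifferentiableAt (𝓡 4) ((𝓡 4).prod 𝓘(ℝ, C2)) (fun y => TotalSpace.mk' C2 y (s y)) x

/-- A smooth Lorentzian metric of signature `(+,-,-,-)` on a four-dimensional manifold. -/
structure LorentzMetric (M : Type*) [TopologicalSpace M] [ChartedSpace R4 M]
    [IsManifold (𝓡 4) ∞ M] where
  /-- The metric as a bilinear form on each tangent space. -/
  val : ∀ x : M, TangentSpace (𝓡 4) x →ₗ[ℝ] TangentSpace (𝓡 4) x →ₗ[ℝ] ℝ
  symm : ∀ x v w, val x v w = val x w v
  signature : ∀ x, ∃ e : Module.Basis (Fin 4) ℝ (TangentSpace (𝓡 4) x), ∀ i j,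
    val x (e i) (e j) = if i = j then (if i = 0 then 1 else -1) else 0
  smooth : ∀ (x : M) (X Y : ∀ y : M, TangentSpace (𝓡 4) y),
    VecSmoothAt X x → VecSmoothAt Y x →
      ContMDiffAt (𝓡 4) 𝓘(ℝ, ℝ) ∞ (fun y => val y (X y) (Y y)) x

variable {M : Type*} [TopologicalSpace M] [ChartedSpace R4 M] [IsManifold (𝓡 4) ∞ M]

/-- `D` is the Levi-Civita connection of `g`: it is torsion-free and `∇g = 0`.
(As everywhere in Mathlib, `D Y x v` stands for `(∇_v Y)(x)`.) -/
structure IsLeviCivita (g : LorentzMetric M)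
    (D : CovariantDerivative (𝓡 4) R4 (TangentSpace (𝓡 4) : M → Type _)) : Prop where
  torsion_free : D.torsion = 0
  metric : ∀ (x : M) (X Y : ∀ y : M, TangentSpace (𝓡 4) y) (v : TangentSpace (𝓡 4) x),
    VecDiffAt X x → VecDiffAt Y x →
      mvfderiv (𝓡 4) (fun y => g.val y (X y) (Y y)) x v = g.val x (D X x v) (Y x) + g.val x (X x) (D Y x v)

end Lorentz

section Spin

variable {M : Type*} [TopologicalSpace M] [ChartedSpace R4 M] [IsManifold (𝓡 4) ∞ M]
  {S : M → Type*} [TopologicalSpace (TotalSpace C2 S)]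
  [∀ x, AddCommGroup (S x)] [∀ x, Module ℂ (S x)] [∀ x, TopologicalSpace (S x)]
  [∀ x, IsTopologicalAddGroup (S x)] [∀ x, ContinuousSMul ℝ (S x)]
  [FiberBundle C2 S] [VectorBundle ℂ C2 S] [VectorBundle ℝ C2 S]
  [ContMDiffVectorBundle ∞ C2 S (𝓡 4)]

/-- Given, at a point, the real part `r s t` of the complex vector `s^A t̄^{A'}`, the spinor form
`α_{AA'} s^A t̄^{A'}` of a complex covector `α`. Since the assignment `(s,t) ↦ s^A t̄^{A'}` is
complex linear in `s`, its imaginary part is `- r (i s) t`, so that this is the complex-linear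
extension of `α` evaluated on `s^A t̄^{A'} = r s t - i r (i s) t`. -/
def spinorForm {T V : Type*} [AddCommGroup V] [Module ℂ V] (r : V → V → T) (α : T → ℂ)
    (s t : V) : ℂ :=
  α (r s t) - Complex.I * α (r (Complex.I • s) t)

/-- A spinor structure on the spacetime `(M, g)`: the rank-two complex vector bundle `S` carries a
spin metric `ε_{AB}`, and `S ⊗ S̄` is identified, compatibly with complex conjugation, with the
complexified tangent bundle in such a way that `g_{ab} = ε_{AB} ε̄_{A'B'}`.

The identification is given by the real part `vecRe x s t` of the complex vector `s^A t̄^{A'}`,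
that is, `½ (s^A t̄^{A'} + t^A s̄^{A'})`. The fields `vecRe_symm` and `vecRe_I` say precisely that
`vecRe` is the real part of a map `S ⊗ S̄ → ℂ ⊗ TM` which is complex linear in `s`, conjugate linear
in `t` and Hermitian; that this map is an isomorphism follows from `metric_eq`. -/
structure SpinorStructure (g : LorentzMetric M) (S : M → Type*)
    [TopologicalSpace (TotalSpace C2 S)]
    [∀ x, AddCommGroup (S x)] [∀ x, Module ℂ (S x)] [∀ x, TopologicalSpace (S x)]
    [∀ x, IsTopologicalAddGroup (S x)] [∀ x, ContinuousSMul ℝ (S x)]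
    [FiberBundle C2 S] [VectorBundle ℂ C2 S] [VectorBundle ℝ C2 S]
    [ContMDiffVectorBundle ∞ C2 S (𝓡 4)] where
  /-- The spin metric: `eps x s t = ε_{AB} s^A t^B`. -/
  eps : ∀ x : M, S x →ₗ[ℂ] S x →ₗ[ℂ] ℂ
  eps_alt : ∀ x s, eps x s s = 0
  exists_frame : ∀ x, ∃ o ι : S x, eps x o ι = 1
  eps_smooth : ∀ (x : M) (s t : ∀ y : M, S y), SpinSmoothAt s x → SpinSmoothAt t x →
    ContMDiffAt (𝓡 4) 𝓘(ℝ, ℂ) ∞ (fun y => eps y (s y) (t y)) x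
  /-- The real part of `s^A t̄^{A'}`. -/
  vecRe : ∀ x : M, S x →ₗ[ℝ] S x →ₗ[ℝ] TangentSpace (𝓡 4) x
  vecRe_symm : ∀ x s t, vecRe x s t = vecRe x t s
  vecRe_I : ∀ x s t, vecRe x (Complex.I • s) (Complex.I • t) = vecRe x s t
  vecRe_smooth : ∀ (x : M) (s t : ∀ y : M, S y), SpinSmoothAt s x → SpinSmoothAt t x →
    VecSmoothAt (fun y => vecRe y (s y) (t y)) x
  /-- `g_{ab} = ε_{AB} ε̄_{A'B'}`, evaluated on `s^A t̄^{A'}` and `u^B w̄^{B'}`. -/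
  metric_eq : ∀ x (s t u w : S x),
    spinorForm (fun s t => vecRe x s t)
      (fun v => spinorForm (fun u w => vecRe x u w) (fun v' => (g.val x v v' : ℂ)) u w) s t
      = eps x s u * conj (eps x t w)

/-- `nab` is the spin connection of the spinor structure: the complex-linear covariant derivative on
`S` under which `ε` is parallel and which induces on `TM` the Levi-Civita connection `D`. (These
properties determine it uniquely.) -/
structure IsSpinConnection {g : LorentzMetric M} (σ : SpinorStructure g S)
    (D : CovariantDerivative (𝓡 4) R4 (TangentSpace (𝓡 4) : M → Type _))
    (nab : CovariantDerivative (𝓡 4) C2 S) : Prop where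
  smul_I : ∀ (x : M) (s : ∀ y : M, S y) (v : TangentSpace (𝓡 4) x), SpinDiffAt s x →
    nab (fun y => Complex.I • s y) x v = Complex.I • nab s x v
  smooth : ∀ (x : M) (X : ∀ y : M, TangentSpace (𝓡 4) y) (s : ∀ y : M, S y),
    VecSmoothAt X x → SpinSmoothAt s x → SpinSmoothAt (fun y => nab s y (X y)) x
  eps_parallel : ∀ (x : M) (s t : ∀ y : M, S y) (v : TangentSpace (𝓡 4) x),
    SpinDiffAt s x → SpinDiffAt t x →
      mvfderiv (𝓡 4) (fun y => σ.eps y (s y) (t y)) x v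
        = σ.eps x (nab s x v) (t x) + σ.eps x (s x) (nab t x v)
  vecRe_parallel : ∀ (x : M) (s t : ∀ y : M, S y) (v : TangentSpace (𝓡 4) x),
    SpinDiffAt s x → SpinDiffAt t x →
      D (fun y => σ.vecRe y (s y) (t y)) x v
        = σ.vecRe x (nab s x v) (t x) + σ.vecRe x (s x) (nab t x v)

/-- A smooth symmetric spinor field `φ_{AB}` of valence `(2,0)`: `val x s t = φ_{AB} s^A t^B`. -/
structure SymSpinor (S : M → Type*)
    [TopologicalSpace (TotalSpace C2 S)]
    [∀ x, AddCommGroup (S x)] [∀ x, Module ℂ (S x)] [∀ x, TopologicalSpace (S x)]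
    [FiberBundle C2 S] where
  val : ∀ x : M, S x →ₗ[ℂ] S x →ₗ[ℂ] ℂ
  symm : ∀ x s t, val x s t = val x t s
  smooth : ∀ (x : M) (s t : ∀ y : M, S y), SpinSmoothAt s x → SpinSmoothAt t x →
    ContMDiffAt (𝓡 4) 𝓘(ℝ, ℂ) ∞ (fun y => val y (s y) (t y)) x

namespace SymSpinor

/-- The components `φ_{AB}` as a function of two spinor arguments. -/
def comp (φ : SymSpinor S) (x : M) (a b : S x) : ℂ := φ.val x a b

end SymSpinor

namespace SpinorStructure

variable {g : LorentzMetric M} (σ : SpinorStructure g S)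

/-! Spinor fields with two lower indices are handled through their values on spinors: a field
`β_{AA'}` is given by `β x a a' = β_{AA'} a^A ā'^{A'}`, complex linear in `a`, conjugate
linear in `a'`, and similarly for `φ_{AB}` and `φ_{A'B'}`. Indices are raised by
`κ^A = ε^{AB} κ_B`, where `ε^{AB} = o^A ι^B - ι^A o^B` for every spin frame, `ε_{AB} o^A ι^B = 1`. -/

/-- The first element of some spin frame at `x`. -/
def frameO (x : M) : S x := (σ.exists_frame x).choose

/-- The second element of some spin frame at `x`. -/
def frameI (x : M) : S x := (σ.exists_frame x).choose_spec.choose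

theorem eps_frame (x : M) : σ.eps x (σ.frameO x) (σ.frameI x) = 1 :=
  (σ.exists_frame x).choose_spec.choose_spec

/-- The contraction `ε^{AB} B_{AB}`; on primed indices, the contraction `ε̄^{A'B'} B_{A'B'}`.
It does not depend on the spin frame: see `up_eq` below. -/
def up (x : M) (B : S x → S x → ℂ) : ℂ :=
  B (σ.frameO x) (σ.frameI x) - B (σ.frameI x) (σ.frameO x)

/-- The directional derivative `∇_{AA'} f` (that is, `𝒯₀,₀ f`) of a complex scalar field. -/
def twist00 (f : M → ℂ) (x : M) (a a' : S x) : ℂ :=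
  spinorForm (fun s t => σ.vecRe x s t) (fun v => mvfderiv (𝓡 4) f x v) a a'

end SpinorStructure

/-- The covariant derivative `∇_v B_{CD}` (or `∇_v B_{CC'}`) of a two-index spinor field along a
real tangent vector, evaluated on `c`, `d`. By the Leibniz rule it does not depend on the choice of
the local sections extending `c` and `d`. -/
def covDeriv (nab : CovariantDerivative (𝓡 4) C2 S) (B : ∀ y : M, S y → S y → ℂ) (x : M)
    (c d : S x) (v : TangentSpace (𝓡 4) x) : ℂ :=
  mvfderiv (𝓡 4) (fun y => B y (extend C2 c y) (extend C2 d y)) x v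
    - B x (nab (extend C2 c) x v) d - B x c (nab (extend C2 d) x v)

namespace SpinorStructure

variable {g : LorentzMetric M} (σ : SpinorStructure g S) (nab : CovariantDerivative (𝓡 4) C2 S)

/-- `∇_{AA'} B_{CD}` (or `∇_{AA'} B_{CC'}`), evaluated on `a`, `a'`, `c`, `d`. -/
def del (B : ∀ y : M, S y → S y → ℂ) (x : M) (a a' c d : S x) : ℂ :=
  spinorForm (fun s t => σ.vecRe x s t) (covDeriv nab B x c d) a a'

/-- `(𝒯₂,₀ φ)_{ABCA'} = ∇_{(A|A'|} φ_{BC)}`. -/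
def twist20 (φ : ∀ y : M, S y → S y → ℂ) (x : M) (a b c a' : S x) : ℂ :=
  (1 / 6) * (σ.del nab φ x a a' b c + σ.del nab φ x a a' c b + σ.del nab φ x b a' a c
    + σ.del nab φ x b a' c a + σ.del nab φ x c a' a b + σ.del nab φ x c a' b a)

/-- `(𝒞†₂,₀ φ)_{AA'} = ∇^B_{A'} φ_{AB}`. -/
def curlDagger20 (φ : ∀ y : M, S y → S y → ℂ) (x : M) (a a' : S x) : ℂ :=
  σ.up x fun b c => σ.del nab φ x c a' a b

/-- `𝒟₁,₁ β = ∇^{BB'} β_{BB'}`. -/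
def div11 (β : ∀ y : M, S y → S y → ℂ) (x : M) : ℂ :=
  σ.up x fun b c => σ.up x fun b' c' => σ.del nab β x c c' b b'

/-- `(𝒞₁,₁ β)_{AB} = ∇_{(A}^{B'} β_{B)B'}`. -/
def curl11 (β : ∀ y : M, S y → S y → ℂ) (x : M) (a b : S x) : ℂ :=
  (1 / 2) * ((σ.up x fun b' c' => σ.del nab β x a c' b b')
    + σ.up x fun b' c' => σ.del nab β x b c' a b')

/-- `(𝒞†₁,₁ β)_{A'B'} = ∇^B_{(A'} β_{|B|B')}`. -/
def curlDagger11 (β : ∀ y : M, S y → S y → ℂ) (x : M) (a' b' : S x) : ℂ :=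
  (1 / 2) * ((σ.up x fun b c => σ.del nab β x c a' b b')
    + σ.up x fun b c => σ.del nab β x c b' b a')

/-- The full contraction `φ_{CD} ψ^{CD}` of two spinor fields of valence `(2,0)`. -/
def inner20 (φ ψ : ∀ y : M, S y → S y → ℂ) (x : M) : ℂ :=
  σ.up x fun c e => σ.up x fun d f => φ x c d * ψ x e f

/-- `U_{AA'} = -½ ∇_{AA'} log(-κ_{CD} κ^{CD})`, where `∇ log f = f⁻¹ ∇ f` for every
local branch of the logarithm. -/
def U (κ : SymSpinor S) (x : M) (a a' : S x) : ℂ :=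
  -(1 / 2) * (σ.twist00 (fun y => -σ.inner20 κ.comp κ.comp y) x a a'
    / (-σ.inner20 κ.comp κ.comp x))

/-- `Υ = κ^{AB} φ_{AB}`. -/
def Upsilon (κ φ : SymSpinor S) (x : M) : ℂ := σ.inner20 φ.comp κ.comp x

/-- `Θ_{AB} = -2 κ_{(A}^C φ_{B)C}`. -/
def Theta (κ φ : SymSpinor S) (x : M) (a b : S x) : ℂ :=
  -2 * ((1 / 2) * ((σ.up x fun c d => κ.comp x a d * φ.comp x b c)
    + σ.up x fun c d => κ.comp x b d * φ.comp x a c))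

/-- `β_{AA'} = (𝒞†₂,₀ Θ)_{AA'} + U^B_{A'} Θ_{AB}`. -/
def beta (κ φ : SymSpinor S) (x : M) (a a' : S x) : ℂ :=
  σ.curlDagger20 nab (σ.Theta κ φ) x a a'
    + σ.up x fun b c => σ.U κ x c a' * σ.Theta κ φ x a b

/-- `κ` is a Killing spinor of valence `(2,0)`: `(𝒯₂,₀ κ)_{ABCA'} = 0`. -/
def IsKillingSpinor (κ : SymSpinor S) : Prop :=
  ∀ (x : M) (a b c a' : S x), σ.twist20 nab κ.comp x a b c a' = 0

/-- `φ` solves the source-free Maxwell equation `(𝒞†₂,₀ φ)_{AA'} = 0`. -/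
def IsMaxwell (φ : SymSpinor S) : Prop :=
  ∀ (x : M) (a a' : S x), σ.curlDagger20 nab φ.comp x a a' = 0

/-- A spin frame is a basis: `v^A = (ε_{BC} v^B ι^C) o^A + (ε_{BC} o^B v^C) ι^A`. -/
theorem eq_frame (x : M) {o ι : S x} (h : σ.eps x o ι = 1) (v : S x) :
    v = σ.eps x v ι • o + σ.eps x o v • ι := by
  have hli : LinearIndependent ℂ ![o, ι] := by
    rw [LinearIndependent.pair_iff]
    intro p q hpq
    constructor
    · have := congrArg (fun w => σ.eps x w ι) hpq
      simpa [σ.eps_alt, h] using this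
    · have := congrArg (fun w => σ.eps x o w) hpq
      simpa [σ.eps_alt, h] using this
  have hfr : Module.finrank ℂ (S x) = 2 := by
    rw [LinearEquiv.finrank_eq ((trivializationAt C2 S x).continuousLinearEquivAt ℂ x
      (FiberBundle.mem_baseSet_trivializationAt C2 S x)).toLinearEquiv]
    simp
  have : FiniteDimensional ℂ (S x) := Module.finite_of_finrank_pos (by omega)
  have hspan := hli.span_eq_top_of_card_eq_finrank' (by simp [hfr])
  have hv : v ∈ Submodule.span ℂ (Set.range ![o, ι]) := by rw [hspan]; trivial
  rw [Matrix.range_cons, Matrix.range_cons, Matrix.range_empty, Set.union_empty,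
    Set.singleton_union, Submodule.mem_span_pair] at hv
  obtain ⟨p, q, rfl⟩ := hv
  simp [σ.eps_alt, h]

/-- The contraction may be computed in any spin frame, both on unprimed indices (`τ` the identity)
and on primed indices (`τ` complex conjugation). -/
theorem up_eq (x : M) {τ : ℂ →+* ℂ} (B : S x →ₛₗ[τ] S x →ₛₗ[τ] ℂ) {o ι : S x}
    (h : σ.eps x o ι = 1) : σ.up x (fun s t => B s t) = B o ι - B ι o := by
  have h0 := σ.eps_frame x
  unfold up
  have hdet : ∀ p q r s : ℂ, σ.eps x (p • o + q • ι) (r • o + s • ι) = p * s - q * r := by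
    intro p q r s
    have hanti : σ.eps x ι o = -1 := by
      have := σ.eps_alt x (o + ι)
      simp only [map_add, LinearMap.add_apply, σ.eps_alt, h] at this
      linear_combination this
    simp only [map_add, map_smul, LinearMap.add_apply, LinearMap.smul_apply, σ.eps_alt, h, hanti,
      smul_eq_mul]
    ring
  generalize σ.frameO x = o' at *
  generalize σ.frameI x = ι' at *
  rw [σ.eq_frame x h o', σ.eq_frame x h ι'] at h0 ⊢
  generalize σ.eps x o' ι = p at *
  generalize σ.eps x o o' = q at *
  generalize σ.eps x ι' ι = r at *
  generalize σ.eps x o ι' = s at *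
  rw [hdet] at h0
  have h1 : τ p * τ s - τ q * τ r = 1 := by
    rw [← map_mul, ← map_mul, ← map_sub, h0, map_one]
  simp only [map_add, LinearMap.map_smulₛₗ, LinearMap.add_apply, LinearMap.smul_apply, smul_eq_mul]
  linear_combination (B o ι - B ι o) * h1

end SpinorStructure

end Spin

end KillingSpinorMaxwell

end

/-! The formula for `β` (`beta_eq`) is pointwise algebra. In a spin frame the Killing equation
leaves, for each primed index, only two independent components of `∇κ`, and Maxwell's equation makes
`∇φ` totally symmetric. The `∇φ` terms of `∇^B_{A'} Θ_{AB}` and of `∇_{AA'} Υ` then agree, and the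
`∇κ` terms are absorbed by `U`, which is itself built from `κ` and `∇κ`.

The two curl equations are the two spinor parts of one identity for covectors, `dβ = U ∧ β`
(`del_beta_antisymm`). Since `U` is a multiple of `f⁻¹ df`, it is closed (`del_U_symm`). Hence `β =
dΥ - Υ U` gives `dβ = -dΥ ∧ U = U ∧ dΥ = U ∧ β`.

The divergence equation comes from the other description of `β`, as the twisted divergence of the
symmetric spinor `Θ`. Write `d_U = d + U ∧`; because `U` is closed, `d_U² = 0`. Up to normalization
`β` is dual to the three-form `d_U F`, where `F = Θ_{AB} ε̄_{A'B'}` (`twistedDiv_dual`), so `d_U d_U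
F = 0` says that `(∇ + U) · β = 0` (`div_twistedDiv`). The Killing and Maxwell equations enter here
only through the smoothness of `β`.

Spinor curvature is never needed. Near each point `F` is written as a finite sum of terms `f dp ∧
dq` with scalar `f`, `p`, `q` (`exists_decomp`). Then `d_U F = ∑ (df + f U) ∧ dp ∧ dq`, and both
steps use only that Hessians of scalars are symmetric (`del_twist00_symm`, from vanishing torsion)
and that `U` is closed. -/

set_option linter.unusedSectionVars false

noncomputable section

namespace KillingSpinorMaxwell

/-! ### Calculus of complex-valued functions on the manifold. -/

section Calculus

variable {M : Type*} [TopologicalSpace M] [ChartedSpace R4 M]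

/-- The complex function `f` is smooth at `x`. -/
abbrev FunSmoothAt (f : M → ℂ) (x : M) : Prop := ContMDiffAt (𝓡 4) 𝓘(ℝ, ℂ) ∞ f x

/-- The complex function `f` is differentiable at `x`. -/
abbrev FunDiffAt (f : M → ℂ) (x : M) : Prop := MDifferentiableAt (𝓡 4) 𝓘(ℝ, ℂ) f x

theorem FunSmoothAt.diffAt {f : M → ℂ} {x : M} (h : FunSmoothAt f x) : FunDiffAt f x :=
  h.mdifferentiableAt (by simp)

theorem FunSmoothAt.comp_contDiffAt {f : M → ℂ} {x : M} {F : ℂ → ℂ} (h : FunSmoothAt f x)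
    (hF : ContDiffAt ℝ ∞ F (f x)) : FunSmoothAt (fun y => F (f y)) x :=
  ContMDiffAt.comp x hF.contMDiffAt h

theorem FunSmoothAt.conj {f : M → ℂ} {x : M} (h : FunSmoothAt f x) :
    FunSmoothAt (fun y => conj (f y)) x :=
  h.comp_contDiffAt Complex.conjCLE.contDiff.contDiffAt

theorem FunSmoothAt.mul {f g : M → ℂ} {x : M} (hf : FunSmoothAt f x) (hg : FunSmoothAt g x) :
    FunSmoothAt (fun y => f y * g y) x :=
  ContMDiffAt.comp (I' := 𝓘(ℝ, ℂ × ℂ)) x (g := fun p : ℂ × ℂ => p.1 * p.2)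
    (contDiff_mul.contDiffAt.contMDiffAt) (hf.prodMk_space hg)

theorem FunSmoothAt.inv {f : M → ℂ} {x : M} (hf : FunSmoothAt f x) (h : f x ≠ 0) :
    FunSmoothAt (fun y => (f y)⁻¹) x :=
  hf.comp_contDiffAt (contDiffAt_inv ℝ h)

theorem FunSmoothAt.add {f g : M → ℂ} {x : M} (hf : FunSmoothAt f x) (hg : FunSmoothAt g x) :
    FunSmoothAt (fun y => f y + g y) x := ContMDiffAt.add hf hg

theorem FunSmoothAt.sub {f g : M → ℂ} {x : M} (hf : FunSmoothAt f x) (hg : FunSmoothAt g x) :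
    FunSmoothAt (fun y => f y - g y) x := ContMDiffAt.sub hf hg

theorem FunSmoothAt.neg {f : M → ℂ} {x : M} (hf : FunSmoothAt f x) :
    FunSmoothAt (fun y => -f y) x := ContMDiffAt.neg hf

theorem funSmoothAt_const {x : M} (c : ℂ) : FunSmoothAt (fun _ : M => c) x := contMDiffAt_const

theorem FunDiffAt.mul {f g : M → ℂ} {x : M} (hf : FunDiffAt f x) (hg : FunDiffAt g x) :
    FunDiffAt (fun y => f y * g y) x :=
  (hf.hasMFDerivAt.mul hg.hasMFDerivAt).mdifferentiableAt

theorem FunDiffAt.add {f g : M → ℂ} {x : M} (hf : FunDiffAt f x) (hg : FunDiffAt g x) :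
    FunDiffAt (fun y => f y + g y) x := MDifferentiableAt.add hf hg

theorem FunDiffAt.sub {f g : M → ℂ} {x : M} (hf : FunDiffAt f x) (hg : FunDiffAt g x) :
    FunDiffAt (fun y => f y - g y) x := MDifferentiableAt.sub hf hg

theorem funDiffAt_const {x : M} (c : ℂ) : FunDiffAt (fun _ : M => c) x := mdifferentiableAt_const

theorem FunDiffAt.comp_clm {f : M → ℂ} {x : M} (F : ℂ →L[ℝ] ℂ) (h : FunDiffAt f x) :
    FunDiffAt (fun y => F (f y)) x :=
  MDifferentiableAt.comp (I' := 𝓘(ℝ, ℂ)) x F.mdifferentiableAt h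

theorem FunDiffAt.conj {f : M → ℂ} {x : M} (h : FunDiffAt f x) :
    FunDiffAt (fun y => conj (f y)) x :=
  h.comp_clm Complex.conjCLE.toContinuousLinearMap

theorem FunDiffAt.inv {f : M → ℂ} {x : M} (h : FunDiffAt f x) (h0 : f x ≠ 0) :
    FunDiffAt (fun y => (f y)⁻¹) x :=
  MDifferentiableAt.comp (I' := 𝓘(ℝ, ℂ)) (g := fun z : ℂ => z⁻¹) x
    ((contDiffAt_inv ℝ h0 (n := 1)).differentiableAt one_ne_zero).mdifferentiableAt h

theorem mvfderiv_mul_apply {f g : M → ℂ} {x : M} (hf : FunDiffAt f x) (hg : FunDiffAt g x)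
    (v : TangentSpace (𝓡 4) x) :
    mvfderiv (𝓡 4) (fun y => f y * g y) x v
      = f x * mvfderiv (𝓡 4) g x v + mvfderiv (𝓡 4) f x v * g x := by
  have := (hf.hasMFDerivAt.mul hg.hasMFDerivAt).mfderiv
  have h2 : mvfderiv (𝓡 4) (fun y => f y * g y) x v = mfderiv (𝓡 4) 𝓘(ℝ, ℂ) (f * g) x v := rfl
  rw [h2, this]
  exact congrArg (f x * mvfderiv (𝓡 4) g x v + ·) (mul_comm (g x) (mvfderiv (𝓡 4) f x v))

theorem mvfderiv_add_apply {f g : M → ℂ} {x : M} (hf : FunDiffAt f x) (hg : FunDiffAt g x)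
    (v : TangentSpace (𝓡 4) x) :
    mvfderiv (𝓡 4) (fun y => f y + g y) x v = mvfderiv (𝓡 4) f x v + mvfderiv (𝓡 4) g x v := by
  rw [mvfderiv_fun_add hf hg]; rfl

theorem mvfderiv_sub_apply {f g : M → ℂ} {x : M} (hf : FunDiffAt f x) (hg : FunDiffAt g x)
    (v : TangentSpace (𝓡 4) x) :
    mvfderiv (𝓡 4) (fun y => f y - g y) x v = mvfderiv (𝓡 4) f x v - mvfderiv (𝓡 4) g x v := by
  rw [mvfderiv_fun_sub hf hg]; rfl

theorem mvfderiv_neg_apply {f : M → ℂ} {x : M} (v : TangentSpace (𝓡 4) x) :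
    mvfderiv (𝓡 4) (fun y => -f y) x v = -mvfderiv (𝓡 4) f x v := by
  rw [mvfderiv_fun_neg]; rfl

theorem mvfderiv_const_apply {x : M} (c : ℂ) (v : TangentSpace (𝓡 4) x) :
    mvfderiv (𝓡 4) (fun _ : M => c) x v = 0 := by
  rw [mvfderiv_const]; rfl

theorem mvfderiv_const_mul_apply {f : M → ℂ} {x : M} (c : ℂ) (hf : FunDiffAt f x)
    (v : TangentSpace (𝓡 4) x) :
    mvfderiv (𝓡 4) (fun y => c * f y) x v = c * mvfderiv (𝓡 4) f x v := by
  rw [mvfderiv_mul_apply (funDiffAt_const c) hf, mvfderiv_const_apply]; ring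

theorem mvfderiv_clm_apply {f : M → ℂ} {x : M} (F : ℂ →L[ℝ] ℂ) (hf : FunDiffAt f x)
    (v : TangentSpace (𝓡 4) x) :
    mvfderiv (𝓡 4) (fun y => F (f y)) x v = F (mvfderiv (𝓡 4) f x v) := by
  have := (HasMFDerivAt.comp x F.hasMFDerivAt hf.hasMFDerivAt).mfderiv
  have h2 : mvfderiv (𝓡 4) (fun y => F (f y)) x v = mfderiv (𝓡 4) 𝓘(ℝ, ℂ) (F ∘ f) x v := rfl
  rw [h2, this]; rfl

theorem mvfderiv_conj_apply {f : M → ℂ} {x : M} (hf : FunDiffAt f x)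
    (v : TangentSpace (𝓡 4) x) :
    mvfderiv (𝓡 4) (fun y => conj (f y)) x v = conj (mvfderiv (𝓡 4) f x v) :=
  mvfderiv_clm_apply Complex.conjCLE.toContinuousLinearMap hf v

/-- Differentiate `f · f⁻¹ = 1`, which holds near `x` because `f` is continuous and nonzero there.
-/
theorem mvfderiv_inv_apply {f : M → ℂ} {x : M} (hf : FunDiffAt f x) (h : f x ≠ 0)
    (v : TangentSpace (𝓡 4) x) :
    mvfderiv (𝓡 4) (fun y => (f y)⁻¹) x v = -mvfderiv (𝓡 4) f x v / f x ^ 2 := by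
  have hc : ContinuousAt f x := hf.continuousAt
  have h1 : (fun y => f y * (f y)⁻¹) =ᶠ[nhds x] fun _ => (1 : ℂ) := by
    filter_upwards [hc.eventually_ne h] with y hy
    exact mul_inv_cancel₀ hy
  have h2 : mvfderiv (𝓡 4) (fun y => f y * (f y)⁻¹) x v = 0 := by
    have := h1.mfderiv_eq (I := 𝓡 4) (I' := 𝓘(ℝ, ℂ))
    have e : mvfderiv (𝓡 4) (fun y => f y * (f y)⁻¹) x v
      = mfderiv (𝓡 4) 𝓘(ℝ, ℂ) (fun y => f y * (f y)⁻¹) x v := rfl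
    rw [e, this]
    exact mvfderiv_const_apply (x := x) (1 : ℂ) v
  rw [mvfderiv_mul_apply hf (hf.inv h)] at h2
  field_simp at h2 ⊢
  linear_combination h2

theorem mvfderiv_congr {f g : M → ℂ} {x : M} (h : f =ᶠ[nhds x] g) (v : TangentSpace (𝓡 4) x) :
    mvfderiv (𝓡 4) f x v = mvfderiv (𝓡 4) g x v := by
  have := h.mfderiv_eq (I := 𝓡 4) (I' := 𝓘(ℝ, ℂ))
  have e : mvfderiv (𝓡 4) f x v = mfderiv (𝓡 4) 𝓘(ℝ, ℂ) f x v := rfl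
  rw [e, this]; rfl

theorem FunDiffAt.sum {J : Type*} (s : Finset J) {f : J → M → ℂ} {x : M}
    (hf : ∀ j ∈ s, FunDiffAt (f j) x) : FunDiffAt (fun y => ∑ j ∈ s, f j y) x := by
  classical
  induction s using Finset.induction_on with
  | empty => simpa using funDiffAt_const (x := x) 0
  | insert a s ha ih =>
    simp only [Finset.sum_insert ha]
    exact (hf a (by simp)).add (ih fun j hj => hf j (by simp [hj]))

theorem mvfderiv_sum_apply {J : Type*} (s : Finset J) {f : J → M → ℂ} {x : M}
    (hf : ∀ j ∈ s, FunDiffAt (f j) x) (v : TangentSpace (𝓡 4) x) :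
    mvfderiv (𝓡 4) (fun y => ∑ j ∈ s, f j y) x v = ∑ j ∈ s, mvfderiv (𝓡 4) (f j) x v := by
  classical
  induction s using Finset.induction_on with
  | empty => simpa using mvfderiv_const_apply (x := x) 0 v
  | insert a s ha ih =>
    simp only [Finset.sum_insert ha]
    rw [mvfderiv_add_apply (hf a (by simp)) (FunDiffAt.sum s fun j hj => hf j (by simp [hj])),
      ih fun j hj => hf j (by simp [hj])]

end Calculus

/-! ### Second derivatives of functions and the Lie bracket. -/

section Bracket

open VectorField

variable {M : Type*} [TopologicalSpace M] [ChartedSpace R4 M] [IsManifold (𝓡 4) ∞ M]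

theorem VecSmoothAt.diffAt {X : ∀ y : M, TangentSpace (𝓡 4) y} {x : M} (h : VecSmoothAt X x) :
    VecDiffAt X x :=
  ContMDiffAt.mdifferentiableAt h (by simp)

theorem FunSmoothAt.mvfderiv_apply {f : M → ℂ} {x : M} {X : ∀ y : M, TangentSpace (𝓡 4) y}
    (hf : FunSmoothAt f x) (hX : VecSmoothAt X x) :
    FunSmoothAt (fun y => mvfderiv (𝓡 4) f y (X y)) x := by
  have h1 := ContMDiffAt.mfderiv_const (m := ∞) hf (by simp)
  have h2 := ContMDiffAt.clm_apply_of_inCoordinates (b₁ := id) (b₂ := f) h1 hX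
    (ContMDiffAt.of_le hf le_rfl)
  exact (contMDiff_snd_tangentBundle_modelSpace ℂ 𝓘(ℝ, ℂ)).contMDiffAt.comp x h2

/-- The chain rule: pulling `X` back applies the inverse of the derivative of the inverse chart, and
this cancels against the derivative of `f ∘ φ⁻¹`. -/
theorem mvfderiv_extChartAt_symm {f : M → ℂ} {x : M} {z : R4} (hz : z ∈ (extChartAt (𝓡 4) x).target)
    (hf : FunDiffAt f ((extChartAt (𝓡 4) x).symm z)) (X : ∀ y : M, TangentSpace (𝓡 4) y) :
    mvfderiv (𝓡 4) f ((extChartAt (𝓡 4) x).symm z) (X ((extChartAt (𝓡 4) x).symm z))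
      = fderiv ℝ (f ∘ (extChartAt (𝓡 4) x).symm) z
        (mpullbackWithin 𝓘(ℝ, R4) (𝓡 4) (extChartAt (𝓡 4) x).symm X (Set.range (𝓡 4)) z) := by
  have hinv := isInvertible_mfderivWithin_extChartAt_symm hz
  have hd : MDifferentiableAt 𝓘(ℝ, R4) (𝓡 4) (extChartAt (𝓡 4) x).symm z := by
    have := mdifferentiableWithinAt_extChartAt_symm hz
    rwa [ModelWithCorners.range_eq_univ, mdifferentiableWithinAt_univ] at this
  rw [mpullbackWithin_apply]
  rw [ModelWithCorners.range_eq_univ, mfderivWithin_univ] at hinv ⊢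
  rw [← mfderiv_eq_fderiv, mfderiv_comp z hf hd]
  obtain ⟨e, he⟩ := hinv
  rw [← he, ContinuousLinearMap.inverse_equiv]
  change _ = mfderiv (𝓡 4) 𝓘(ℝ, ℂ) f _ (e (e.symm _))
  rw [e.apply_symm_apply]
  rfl

/-- In a chart each iterated derivative is a `D²F` term plus `DF` applied to the derivative of a
vector field. The `D²F` terms cancel by symmetry, and what remains is `DF` of the flat bracket. -/
theorem mvfderiv_mlieBracket {f : M → ℂ} {x : M} {V W : ∀ y : M, TangentSpace (𝓡 4) y}
    (hf : FunSmoothAt f x) (hV : VecSmoothAt V x) (hW : VecSmoothAt W x) :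
    mvfderiv (𝓡 4) (fun y => mvfderiv (𝓡 4) f y (W y)) x (V x)
      - mvfderiv (𝓡 4) (fun y => mvfderiv (𝓡 4) f y (V y)) x (W x)
      = mvfderiv (𝓡 4) f x (mlieBracket (𝓡 4) V W x) := by
  have hM : IsManifold (𝓡 4) 2 M := inferInstance
  set φ := extChartAt (𝓡 4) x with hφ
  set z := φ x with hz
  have hzt : z ∈ φ.target := mem_extChartAt_target x
  have hxz : φ.symm z = x := extChartAt_to_inv x
  set F := f ∘ φ.symm with hF
  set P : (∀ y : M, TangentSpace (𝓡 4) y) → R4 → R4 := fun X =>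
    mpullbackWithin 𝓘(ℝ, R4) (𝓡 4) φ.symm X (Set.range (𝓡 4)) with hP
  have key : ∀ {h : M → ℂ} (_ : FunDiffAt h x) (X : ∀ y : M, TangentSpace (𝓡 4) y),
      mvfderiv (𝓡 4) h x (X x) = fderiv ℝ (h ∘ φ.symm) z (P X z) := by
    intro h hh X
    have := mvfderiv_extChartAt_symm (f := h) hzt (by rw [← hφ, hxz]; exact hh) X
    rw [← hφ, hxz] at this
    exact this
  have hFs : ContDiffAt ℝ ∞ F z := by
    have h1 : ContMDiffAt 𝓘(ℝ, R4) (𝓡 4) ∞ φ.symm z := by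
      have := contMDiffWithinAt_extChartAt_symm_range (I := 𝓡 4) (n := ∞) x hzt
      rwa [ModelWithCorners.range_eq_univ, contMDiffWithinAt_univ] at this
    exact (ContMDiffAt.comp z (by rw [hxz]; exact hf) h1).contDiffAt
  have hPd : ∀ {X : ∀ y : M, TangentSpace (𝓡 4) y}, VecSmoothAt X x →
      DifferentiableAt ℝ (P X) z := by
    intro X hX
    have := MDifferentiableWithinAt.differentiableWithinAt_mpullbackWithin_vectorField (s := Set.univ)
      (hX.diffAt.mdifferentiableWithinAt)
    rw [Set.preimage_univ, Set.univ_inter] at this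
    exact this.differentiableAt (by rw [ModelWithCorners.range_eq_univ]; exact Filter.univ_mem)
  -- The chart formula is needed on a neighbourhood, since it is differentiated once more.
  have hev : ∀ X : ∀ y : M, TangentSpace (𝓡 4) y,
      (fun y => mvfderiv (𝓡 4) f y (X y)) ∘ φ.symm =ᶠ[nhds z] fun w => fderiv ℝ F w (P X w) := by
    intro X
    have h1 : ∀ᶠ y in nhds x, FunDiffAt f y := by
      have h2 : ContMDiffAt (𝓡 4) 𝓘(ℝ, ℂ) 1 f x := ContMDiffAt.of_le hf (by simp)
      filter_upwards [(contMDiffAt_iff_contMDiffAt_nhds (by simp)).1 h2] with y hy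
      exact ContMDiffAt.mdifferentiableAt hy one_ne_zero
    have hc : Filter.Tendsto φ.symm (nhds z) (nhds x) := by
      have := continuousAt_extChartAt_symm (I := 𝓡 4) x
      rw [ContinuousAt, ← hφ, ← hz, hxz] at this
      exact this
    filter_upwards [hc.eventually h1, extChartAt_target_mem_nhds (I := 𝓡 4) x] with w hw hwt
    exact mvfderiv_extChartAt_symm hwt hw X
  have h2 : ∀ {X : ∀ y : M, TangentSpace (𝓡 4) y}, VecSmoothAt X x → ∀ v,
      fderiv ℝ ((fun y => mvfderiv (𝓡 4) f y (X y)) ∘ φ.symm) z v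
        = fderiv ℝ (fderiv ℝ F) z v (P X z) + fderiv ℝ F z (fderiv ℝ (P X) z v) := by
    intro X hX v
    rw [(hev X).fderiv_eq]
    have hdF : DifferentiableAt ℝ (fderiv ℝ F) z :=
      (hFs.fderiv_right (m := 1) (by norm_cast)).differentiableAt one_ne_zero
    rw [fderiv_clm_apply hdF (hPd hX)]
    simp [add_comm]
  have hsym : IsSymmSndFDerivAt ℝ F z := hFs.isSymmSndFDerivAt (by
    rw [minSmoothness_of_isRCLikeNormedField]; exact_mod_cast ENat.LEInfty.out)
  have hbr : mvfderiv (𝓡 4) f x (mlieBracket (𝓡 4) V W x)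
      = fderiv ℝ F z (lieBracket ℝ (P V) (P W) z) := by
    have e1 : mlieBracket (𝓡 4) V W x
        = (mfderiv (𝓡 4) 𝓘(ℝ, R4) φ x).inverse (lieBracket ℝ (P V) (P W) z) := by
      rw [← mlieBracketWithin_univ, mlieBracketWithin_apply, Set.preimage_univ, Set.univ_inter]
      have e2 : lieBracketWithin ℝ (P V) (P W) (Set.range (𝓡 4)) z
          = lieBracket ℝ (P V) (P W) z := by
        rw [ModelWithCorners.range_eq_univ, lieBracketWithin_univ]
      exact congrArg (mfderiv (𝓡 4) 𝓘(ℝ, R4) φ x).inverse e2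
    have hfeq : f =ᶠ[nhds x] F ∘ φ := by
      filter_upwards [extChartAt_source_mem_nhds (I := 𝓡 4) x] with y hy
      simp only [hF, Function.comp_apply, φ.left_inv hy]
    rw [mvfderiv_congr hfeq]
    have hφd : MDifferentiableAt (𝓡 4) 𝓘(ℝ, R4) φ x :=
      mdifferentiableAt_extChartAt (mem_chart_source _ x)
    have hFd : MDifferentiableAt 𝓘(ℝ, R4) 𝓘(ℝ, ℂ) F (φ x) :=
      (hFs.differentiableAt (by simp)).mdifferentiableAt
    change mfderiv (𝓡 4) 𝓘(ℝ, ℂ) (F ∘ φ) x _ = _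
    rw [mfderiv_comp_apply x hFd hφd, e1]
    obtain ⟨e, he⟩ := isInvertible_mfderiv_extChartAt (I := 𝓡 4)
      (mem_extChartAt_source (I := 𝓡 4) x)
    rw [← hφ] at he
    rw [← he, ContinuousLinearMap.inverse_equiv]
    change mfderiv 𝓘(ℝ, R4) 𝓘(ℝ, ℂ) F z (e (e.symm _)) = _
    rw [e.apply_symm_apply, mfderiv_eq_fderiv]
    rfl
  rw [key (hf.mvfderiv_apply hW).diffAt, key (hf.mvfderiv_apply hV).diffAt, h2 hW, h2 hV, hbr,
    lieBracket_eq, map_sub, hsym.eq]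
  ring

end Bracket

/-! ### Semilinearity of the spinor form of a covector. -/

section SpinorAlgebra

/-- `h` is semilinear with respect to `τ`, as a mere function. -/
structure IsSemilinear {V : Type*} [AddCommGroup V] [Module ℂ V] (τ : ℂ →+* ℂ) (h : V → ℂ) :
    Prop where
  add : ∀ s t, h (s + t) = h s + h t
  smul : ∀ z s, h (z • s) = τ z * h s

/-- For a real-linear `h`, the function `h(s) - i h(i s)` is twice its complex-linear part. -/
theorem spinorForm_isSemilinear_left {T V : Type*} [AddCommGroup T] [Module ℝ T] [AddCommGroup V]
    [Module ℂ V] (r : V →ₗ[ℝ] V →ₗ[ℝ] T) (α : T →ₗ[ℝ] ℂ) (t : V) :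
    IsSemilinear (RingHom.id ℂ) fun s => spinorForm (fun s t => r s t) α s t where
  add s s' := by simp [spinorForm]; ring
  smul z s := by
    have key : ∀ w : V, r (z • w) t = z.re • r w t + z.im • r (Complex.I • w) t := by
      intro w
      have hz : z • w = z.re • w + z.im • (Complex.I • w) := by
        conv_lhs => rw [← Complex.re_add_im z]
        rw [add_smul, mul_smul, Complex.coe_smul, Complex.coe_smul]
      rw [hz]; simp
    have hI : Complex.I • z • s = z • Complex.I • s := smul_comm _ _ _
    have hII : Complex.I • Complex.I • s = -s := by
      rw [smul_smul, Complex.I_mul_I, neg_one_smul]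
    have e : (z.re : ℂ) + z.im * Complex.I = z := Complex.re_add_im z
    simp only [spinorForm, hI, key, hII, map_add, map_smul, map_neg, LinearMap.neg_apply,
      Complex.real_smul, RingHom.id_apply, smul_neg]
    generalize α (r s t) = p
    generalize α (r (Complex.I • s) t) = q
    linear_combination (p - Complex.I * q) * e + z.im * q * Complex.I_mul_I

/-- Invariance of `r` under simultaneous multiplication by `i` gives `r s (i t) = -r (i s) t`, so a
factor `i` in the second slot comes out as `-i`. -/
theorem spinorForm_isSemilinear_right {T V : Type*} [AddCommGroup T] [Module ℝ T] [AddCommGroup V]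
    [Module ℂ V] (r : V →ₗ[ℝ] V →ₗ[ℝ] T)
    (hr : ∀ s t, r (Complex.I • s) (Complex.I • t) = r s t) (α : T →ₗ[ℝ] ℂ) (s : V) :
    IsSemilinear (starRingEnd ℂ) fun t => spinorForm (fun s t => r s t) α s t where
  add t t' := by simp [spinorForm]; ring
  smul z t := by
    have hII : ∀ w : V, Complex.I • Complex.I • w = -w := fun w => by
      rw [smul_smul, Complex.I_mul_I, neg_one_smul]
    have hr' : ∀ s t, r s (Complex.I • t) = -r (Complex.I • s) t := fun s t => by
      have := hr (Complex.I • s) t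
      rw [hII] at this
      rw [← this]; simp
    have key : ∀ w : V, r w (z • t) = z.re • r w t - z.im • r (Complex.I • w) t := by
      intro w
      have hz : z • t = z.re • t + z.im • (Complex.I • t) := by
        conv_lhs => rw [← Complex.re_add_im z]
        rw [add_smul, mul_smul, Complex.coe_smul, Complex.coe_smul]
      rw [hz]; simp [hr', sub_eq_add_neg]
    have e : conj z = (z.re : ℂ) - z.im * Complex.I := by
      apply Complex.ext <;> simp
    simp only [spinorForm, key, hII, map_sub, map_smul, map_neg, LinearMap.neg_apply,
      Complex.real_smul, smul_neg, e]
    generalize α (r s t) = p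
    generalize α (r (Complex.I • s) t) = q
    linear_combination (-z.im * q) * Complex.I_mul_I

end SpinorAlgebra

/-! ### Local extensions of spinors and covariant derivatives of two-index fields. -/

section Spin

variable {M : Type*} [TopologicalSpace M] [ChartedSpace R4 M] [IsManifold (𝓡 4) ∞ M]
  {S : M → Type*} [TopologicalSpace (TotalSpace C2 S)]
  [∀ x, AddCommGroup (S x)] [∀ x, Module ℂ (S x)] [∀ x, TopologicalSpace (S x)]
  [∀ x, IsTopologicalAddGroup (S x)] [∀ x, ContinuousSMul ℝ (S x)]
  [FiberBundle C2 S] [VectorBundle ℂ C2 S] [VectorBundle ℝ C2 S]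
  [ContMDiffVectorBundle ∞ C2 S (𝓡 4)]

theorem spinSmoothAt_extend {x : M} (c : S x) : SpinSmoothAt (extend C2 c) x :=
  contMDiffAt_extend (𝓡 4) C2 c

theorem eventually_spinSmoothAt_extend {x : M} (c : S x) :
    ∀ᶠ y in nhds x, SpinSmoothAt (extend C2 c) y := by
  obtain ⟨s, hs, h⟩ := exists_contMDiffOn_extend (k := ∞) (𝓡 4) C2 c
  filter_upwards [eventually_mem_nhds_iff.2 hs] with y hy using h.contMDiffAt hy

theorem SpinSmoothAt.diffAt {s : ∀ y : M, S y} {x : M} (h : SpinSmoothAt s x) : SpinDiffAt s x :=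
  ContMDiffAt.mdifferentiableAt h (by simp)

/-- An extension is constant in a local trivialization, so it depends linearly on its initial value
over the base set only. Germs suffice for derivatives. -/
theorem eventually_extend_add {x : M} (c d : S x) :
    ∀ᶠ y in nhds x, extend C2 (c + d) y = extend C2 c y + extend C2 d y := by
  filter_upwards [(trivializationAt C2 S x).open_baseSet.mem_nhds
    (mem_baseSet_trivializationAt' x)] with y hy
  simp only [extend]
  rw [← Trivialization.coe_symmₗ (R := ℂ) _ hy, ← map_add]
  congr 1
  exact (Trivialization.linear ℂ _ (mem_baseSet_trivializationAt' x)).map_add c d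

theorem eventually_extend_smul {x : M} (z : ℂ) (c : S x) :
    ∀ᶠ y in nhds x, extend C2 (z • c) y = z • extend C2 c y := by
  filter_upwards [(trivializationAt C2 S x).open_baseSet.mem_nhds
    (mem_baseSet_trivializationAt' x)] with y hy
  simp only [extend]
  rw [← Trivialization.coe_symmₗ (R := ℂ) _ hy, ← map_smul]
  congr 1
  exact (Trivialization.linear ℂ _ (mem_baseSet_trivializationAt' x)).map_smul z c

theorem SpinSmoothAt.smul_I {s : ∀ y : M, S y} {x : M} (h : SpinSmoothAt s x) :
    SpinSmoothAt (fun y => Complex.I • s y) x := by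
  rw [SpinSmoothAt, contMDiffAt_section] at h ⊢
  have h2 : ContMDiffAt (𝓡 4) 𝓘(ℝ, C2) ∞
      (fun y => (Complex.I • (trivializationAt C2 S x ⟨y, s y⟩).2 : C2)) x :=
    ((contDiff_const_smul (𝕜 := ℝ) Complex.I).contDiffAt.contMDiffAt).comp x h
  refine h2.congr_of_eventuallyEq ?_
  filter_upwards [(trivializationAt C2 S x).open_baseSet.mem_nhds
    (mem_baseSet_trivializationAt' x)] with y hy
  exact (Trivialization.linear ℂ _ hy).map_smul _ _

/-- `B` is a field of forms on `S`, complex linear in the first argument and `τ`-semilinear in the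
second, where `τ` is the identity or the complex conjugation. -/
structure IsSesquilinearField (τ : ℂ →+* ℂ) (B : ∀ y : M, S y → S y → ℂ) : Prop where
  real : ∀ r : ℝ, τ r = r
  left : ∀ y d, IsSemilinear (RingHom.id ℂ) fun c => B y c d
  right : ∀ y c, IsSemilinear τ (B y c)

/-- `B` maps sections which are smooth at `x` to functions which are smooth at `x`. -/
def FieldSmoothAt (B : ∀ y : M, S y → S y → ℂ) (x : M) : Prop :=
  ∀ s t : ∀ y : M, S y, SpinSmoothAt s x → SpinSmoothAt t x →
    FunSmoothAt (fun y => B y (s y) (t y)) x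

theorem FieldSmoothAt.diffAt_extend {B : ∀ y : M, S y → S y → ℂ} {x : M} (h : FieldSmoothAt B x)
    (c d : S x) : FunDiffAt (fun y => B y (extend C2 c y) (extend C2 d y)) x :=
  (h _ _ (spinSmoothAt_extend c) (spinSmoothAt_extend d)).diffAt

variable {g : LorentzMetric M} {σ : SpinorStructure g S}
  {D : CovariantDerivative (𝓡 4) R4 (TangentSpace (𝓡 4) : M → Type _)}
  {nab : CovariantDerivative (𝓡 4) C2 S}

theorem mvfderiv_extend (nab : CovariantDerivative (𝓡 4) C2 S) (B : ∀ y : M, S y → S y → ℂ)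
    {x : M} (c d : S x) (v : TangentSpace (𝓡 4) x) :
    mvfderiv (𝓡 4) (fun y => B y (extend C2 c y) (extend C2 d y)) x v
      = covDeriv nab B x c d v + B x (nab (extend C2 c) x v) d
        + B x c (nab (extend C2 d) x v) := by
  unfold covDeriv; ring

namespace IsSpinConnection

theorem mvfderiv_eps (h : IsSpinConnection σ D nab) {x : M} (c d : S x)
    (v : TangentSpace (𝓡 4) x) :
    mvfderiv (𝓡 4) (fun y => σ.eps y (extend C2 c y) (extend C2 d y)) x v
      = σ.eps x (nab (extend C2 c) x v) d + σ.eps x c (nab (extend C2 d) x v) := by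
  have := h.eps_parallel x (extend C2 c) (extend C2 d) v (spinSmoothAt_extend c).diffAt
    (spinSmoothAt_extend d).diffAt
  simpa using this

theorem nab_extend_add (_h : IsSpinConnection σ D nab) {x : M} (c d : S x)
    (v : TangentSpace (𝓡 4) x) :
    nab (extend C2 (c + d)) x v = nab (extend C2 c) x v + nab (extend C2 d) x v := by
  have hc := (spinSmoothAt_extend c).diffAt
  have hd := (spinSmoothAt_extend d).diffAt
  have e := nab.isCovariantDerivativeOnUniv.congr_of_eventuallyEq
    (spinSmoothAt_extend (c + d)).diffAt (mdifferentiableAt_add_section hc hd) Filter.univ_mem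
    (eventually_extend_add c d)
  rw [e]
  exact congrArg (fun L => L v) (nab.isCovariantDerivativeOnUniv.add hc hd)

/-- The connection is a priori only real linear; complex scalars are reached through the separate
hypothesis that it commutes with `i`. -/
theorem nab_extend_smul (h : IsSpinConnection σ D nab) {x : M} (z : ℂ) (c : S x)
    (v : TangentSpace (𝓡 4) x) :
    nab (extend C2 (z • c)) x v = z • nab (extend C2 c) x v := by
  have hreal : ∀ (r : ℝ) (d : S x), nab (extend C2 (r • d)) x v = r • nab (extend C2 d) x v := by
    intro r d
    have hd := (spinSmoothAt_extend d).diffAt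
    have hev : ∀ᶠ y in nhds x, extend C2 (r • d) y = (r • extend C2 d) y := by
      filter_upwards [eventually_extend_smul (r : ℂ) d] with y hy
      rwa [Complex.coe_smul, Complex.coe_smul] at hy
    have hrd : SpinDiffAt (r • extend C2 d) x :=
      (mdifferentiableAt_const (c := r)).smul_section hd
    rw [nab.isCovariantDerivativeOnUniv.congr_of_eventuallyEq (spinSmoothAt_extend _).diffAt
      hrd Filter.univ_mem hev, nab.isCovariantDerivativeOnUniv.smul_const r hd]
    rfl
  have hI : ∀ d : S x, nab (extend C2 (Complex.I • d)) x v
      = Complex.I • nab (extend C2 d) x v := by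
    intro d
    have hd := spinSmoothAt_extend d
    rw [nab.isCovariantDerivativeOnUniv.congr_of_eventuallyEq (spinSmoothAt_extend _).diffAt
      hd.smul_I.diffAt Filter.univ_mem (eventually_extend_smul Complex.I d),
      h.smul_I x _ v hd.diffAt]
  have hz : ∀ w : S x, z • w = z.re • w + z.im • (Complex.I • w) := by
    intro w
    conv_lhs => rw [← Complex.re_add_im z]
    rw [add_smul, mul_smul, Complex.coe_smul, Complex.coe_smul]
  rw [hz, hz, h.nab_extend_add, hreal, hreal, hI]

theorem covDeriv_left (h : IsSpinConnection σ D nab) {τ : ℂ →+* ℂ}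
    {B : ∀ y : M, S y → S y → ℂ} (hB : IsSesquilinearField τ B) {x : M} (hs : FieldSmoothAt B x)
    (d : S x) (v : TangentSpace (𝓡 4) x) :
    IsSemilinear (RingHom.id ℂ) fun c => covDeriv nab B x c d v where
  add c c' := by
    have e : (fun y => B y (extend C2 (c + c') y) (extend C2 d y)) =ᶠ[nhds x]
        fun y => B y (extend C2 c y) (extend C2 d y) + B y (extend C2 c' y) (extend C2 d y) := by
      filter_upwards [eventually_extend_add c c'] with y hy
      rw [hy, (hB.left _ _).add]
    simp only [covDeriv, h.nab_extend_add, (hB.left _ _).add]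
    rw [mvfderiv_congr e, mvfderiv_add_apply (hs.diffAt_extend c d) (hs.diffAt_extend c' d)]
    ring
  smul z c := by
    have e : (fun y => B y (extend C2 (z • c) y) (extend C2 d y)) =ᶠ[nhds x]
        fun y => z * B y (extend C2 c y) (extend C2 d y) := by
      filter_upwards [eventually_extend_smul z c] with y hy
      rw [hy, (hB.left _ _).smul]; rfl
    simp only [covDeriv, h.nab_extend_smul, (hB.left _ _).smul]
    rw [mvfderiv_congr e, mvfderiv_const_mul_apply _ (hs.diffAt_extend c d)]
    simp only [RingHom.id_apply]; ring

theorem covDeriv_right (h : IsSpinConnection σ D nab) {τ : ℂ →+* ℂ}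
    {B : ∀ y : M, S y → S y → ℂ} (hB : IsSesquilinearField τ B) {x : M} (hs : FieldSmoothAt B x)
    (c : S x) (v : TangentSpace (𝓡 4) x) :
    IsSemilinear τ fun d => covDeriv nab B x c d v where
  add d d' := by
    have e : (fun y => B y (extend C2 c y) (extend C2 (d + d') y)) =ᶠ[nhds x]
        fun y => B y (extend C2 c y) (extend C2 d y) + B y (extend C2 c y) (extend C2 d' y) := by
      filter_upwards [eventually_extend_add d d'] with y hy
      rw [hy, (hB.right _ _).add]
    simp only [covDeriv, h.nab_extend_add, (hB.right _ _).add]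
    rw [mvfderiv_congr e, mvfderiv_add_apply (hs.diffAt_extend c d) (hs.diffAt_extend c d')]
    ring
  smul z d := by
    have e : (fun y => B y (extend C2 c y) (extend C2 (z • d) y)) =ᶠ[nhds x]
        fun y => τ z * B y (extend C2 c y) (extend C2 d y) := by
      filter_upwards [eventually_extend_smul z d] with y hy
      rw [hy, (hB.right _ _).smul]
    simp only [covDeriv, h.nab_extend_smul, (hB.right _ _).smul]
    rw [mvfderiv_congr e, mvfderiv_const_mul_apply _ (hs.diffAt_extend c d)]
    ring

end IsSpinConnection

/-- The covariant derivative of a field of forms, as a linear function of the direction. -/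
def covDerivLin (nab : CovariantDerivative (𝓡 4) C2 S) {τ : ℂ →+* ℂ}
    {B : ∀ y : M, S y → S y → ℂ} (hB : IsSesquilinearField τ B) (x : M) (c d : S x) :
    TangentSpace (𝓡 4) x →ₗ[ℝ] ℂ where
  toFun := covDeriv nab B x c d
  map_add' v w := by
    simp only [covDeriv, map_add, (hB.left _ _).add, (hB.right _ _).add]; ring
  map_smul' r v := by
    have h1 : ∀ s : S x, B x (r • s) d = r * B x s d := fun s => by
      rw [← Complex.coe_smul, (hB.left _ _).smul]; rfl
    have h2 : ∀ s : S x, B x c (r • s) = r * B x c s := fun s => by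
      rw [← Complex.coe_smul, (hB.right _ _).smul, hB.real]
    simp only [covDeriv, map_smul, h1, h2, Complex.real_smul, RingHom.id_apply]; ring

/-! ### Two-dimensional spinor algebra and linearity of `∇B` in each slot. -/

namespace SpinorStructure

variable (σ)

theorem eps_antisymm (x : M) (s t : S x) : σ.eps x s t = -σ.eps x t s := by
  have := σ.eps_alt x (s + t)
  simp only [map_add, LinearMap.add_apply, σ.eps_alt] at this
  linear_combination this

theorem _root_.KillingSpinorMaxwell.IsSemilinear.eq_frame {x : M} {τ : ℂ →+* ℂ} {h : S x → ℂ}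
    (hh : IsSemilinear τ h) {o ι : S x} (hoι : σ.eps x o ι = 1) (v : S x) :
    h v = τ (σ.eps x v ι) * h o + τ (σ.eps x o v) * h ι := by
  conv_lhs => rw [σ.eq_frame x hoι v]
  rw [hh.add, hh.smul, hh.smul]

/-- Since spin space is two-dimensional, antisymmetrizing over three indices gives zero. -/
theorem schouten {x : M} {τ : ℂ →+* ℂ} {h : S x → ℂ} (hh : IsSemilinear τ h) (a b c : S x) :
    τ (σ.eps x b c) * h a + τ (σ.eps x c a) * h b + τ (σ.eps x a b) * h c = 0 := by
  have h0 := σ.eps_frame x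
  have e : ∀ p q : S x, σ.eps x p q = σ.eps x p (σ.frameI x) * σ.eps x (σ.frameO x) q
      - σ.eps x (σ.frameO x) p * σ.eps x q (σ.frameI x) := by
    intro p q
    conv_lhs => rw [σ.eq_frame x h0 p]
    simp only [map_add, map_smul, LinearMap.add_apply, LinearMap.smul_apply, smul_eq_mul]
    rw [σ.eps_antisymm x (σ.frameI x) q]; ring
  rw [hh.eq_frame σ h0 a, hh.eq_frame σ h0 b, hh.eq_frame σ h0 c, e a b, e b c, e c a]
  simp only [map_sub, map_mul]
  ring

/-- An antisymmetric pair of indices is proportional to the spin metric. -/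
theorem antisymm_eq {x : M} {τ : ℂ →+* ℂ} {G : S x → S x → ℂ}
    (h1 : ∀ t, IsSemilinear τ fun s => G s t)
    (h2 : ∀ s, IsSemilinear τ (G s)) (a c : S x) :
    G a c - G c a = τ (σ.eps x a c) * σ.up x G := by
  have h0 := σ.eps_frame x
  -- Applied to `ε(o, ·)`, the three-index identity writes `ε(a, c)` as the determinant of the frame
  -- components of `a` and `c`.
  have e := σ.schouten (τ := τ) (h := fun s => τ (σ.eps x (σ.frameO x) s))
    ⟨fun s t => by simp, fun z s => by simp⟩ (σ.frameI x) a c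
  simp only [h0, map_one, mul_one] at e
  rw [(h1 c).eq_frame σ h0 a, (h1 a).eq_frame σ h0 c, (h2 _).eq_frame σ h0 a,
    (h2 _).eq_frame σ h0 a,
    (h2 _).eq_frame σ h0 c, (h2 _).eq_frame σ h0 c, up]
  rw [σ.eps_antisymm x (σ.frameI x) a, map_neg] at e
  linear_combination (-G (σ.frameO x) (σ.frameI x) + G (σ.frameI x) (σ.frameO x)) * e

theorem twist00_isSesquilinearField (f : M → ℂ) :
    IsSesquilinearField (starRingEnd ℂ) (σ.twist00 f) where
  real r := Complex.conj_ofReal r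
  left y d := spinorForm_isSemilinear_left (σ.vecRe y) (mvfderiv (𝓡 4) f y).toLinearMap d
  right y c := spinorForm_isSemilinear_right (σ.vecRe y) (σ.vecRe_I y)
    (mvfderiv (𝓡 4) f y).toLinearMap c

theorem twist00_smooth {f : M → ℂ} {x : M} (hf : FunSmoothAt f x) :
    FieldSmoothAt (σ.twist00 f) x := by
  intro s t hs ht
  exact (hf.mvfderiv_apply (σ.vecRe_smooth x s t hs ht)).sub
    ((funSmoothAt_const Complex.I).mul
      (hf.mvfderiv_apply (σ.vecRe_smooth x _ t hs.smul_I ht)))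

theorem del_isSemilinear₁ {τ : ℂ →+* ℂ}
    {B : ∀ y : M, S y → S y → ℂ} (hB : IsSesquilinearField τ B) (x : M) (a' c d : S x) :
    IsSemilinear (RingHom.id ℂ) fun a => σ.del nab B x a a' c d :=
  spinorForm_isSemilinear_left (σ.vecRe x) (covDerivLin nab hB x c d) a'

theorem del_isSemilinear₂ {τ : ℂ →+* ℂ}
    {B : ∀ y : M, S y → S y → ℂ} (hB : IsSesquilinearField τ B) (x : M) (a c d : S x) :
    IsSemilinear (starRingEnd ℂ) fun a' => σ.del nab B x a a' c d :=
  spinorForm_isSemilinear_right (σ.vecRe x) (σ.vecRe_I x) (covDerivLin nab hB x c d) a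

variable {σ}

theorem del_isSemilinear₃ (h : IsSpinConnection σ D nab) {τ : ℂ →+* ℂ}
    {B : ∀ y : M, S y → S y → ℂ} (hB : IsSesquilinearField τ B) {x : M} (hs : FieldSmoothAt B x)
    (a a' d : S x) :
    IsSemilinear (RingHom.id ℂ) fun c => σ.del nab B x a a' c d where
  add c c' := by
    simp only [del, spinorForm, (h.covDeriv_left hB hs d _).add]; ring
  smul z c := by
    simp only [del, spinorForm, (h.covDeriv_left hB hs d _).smul]; ring

theorem del_isSemilinear₄ (h : IsSpinConnection σ D nab) {τ : ℂ →+* ℂ}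
    {B : ∀ y : M, S y → S y → ℂ} (hB : IsSesquilinearField τ B) {x : M} (hs : FieldSmoothAt B x)
    (a a' c : S x) :
    IsSemilinear τ fun d => σ.del nab B x a a' c d where
  add d d' := by
    simp only [del, spinorForm, (h.covDeriv_right hB hs c _).add]; ring
  smul z d := by
    simp only [del, spinorForm, (h.covDeriv_right hB hs c _).smul]; ring

end SpinorStructure

/-! ### Symmetry of second covariant derivatives of scalars. -/

/-- The Hessian of a function is symmetric. -/
theorem hessian_symm (hD : D.torsion = 0) {f : M → ℂ} {x : M} {V W : ∀ y : M, TangentSpace (𝓡 4) y}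
    (hf : FunSmoothAt f x) (hV : VecSmoothAt V x) (hW : VecSmoothAt W x) :
    mvfderiv (𝓡 4) (fun y => mvfderiv (𝓡 4) f y (W y)) x (V x) - mvfderiv (𝓡 4) f x (D W x (V x))
      = mvfderiv (𝓡 4) (fun y => mvfderiv (𝓡 4) f y (V y)) x (W x)
        - mvfderiv (𝓡 4) f x (D V x (W x)) := by
  have h1 := mvfderiv_mlieBracket hf hV hW
  have h2 := D.torsion_apply hV.diffAt hW.diffAt
  rw [hD] at h2
  have h3 := congrArg (mvfderiv (𝓡 4) f x) h2
  simp only [map_sub] at h3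
  have h4 : mvfderiv (𝓡 4) f x (((0 : ∀ x : M, TangentSpace (𝓡 4) x →L[ℝ] TangentSpace (𝓡 4) x →L[ℝ]
      TangentSpace (𝓡 4) x) x (V x)) (W x)) = 0 := by
    simp
  rw [h4] at h3
  linear_combination h1 + h3

namespace SpinorStructure

/-- Because the spin connection induces `D`, the two correction terms of the spinor derivative
combine into `df` of `D_v` of the vector field. The derivative of a gradient is thus the Hessian of
`f` with respect to `D`. -/
theorem covDeriv_twist00 (h : IsSpinConnection σ D nab) {f : M → ℂ} {x : M}
    (hf : FunSmoothAt f x) (b b' : S x) (v : TangentSpace (𝓡 4) x) :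
    covDeriv nab (σ.twist00 f) x b b' v
      = (mvfderiv (𝓡 4) (fun y => mvfderiv (𝓡 4) f y
            (σ.vecRe y (extend C2 b y) (extend C2 b' y))) x v
          - mvfderiv (𝓡 4) f x (D (fun y => σ.vecRe y (extend C2 b y) (extend C2 b' y)) x v))
        - Complex.I * (mvfderiv (𝓡 4) (fun y => mvfderiv (𝓡 4) f y
            (σ.vecRe y (Complex.I • extend C2 b y) (extend C2 b' y))) x v
          - mvfderiv (𝓡 4) f x
            (D (fun y => σ.vecRe y (Complex.I • extend C2 b y) (extend C2 b' y)) x v)) := by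
  have hb := spinSmoothAt_extend (S := S) b
  have hb' := spinSmoothAt_extend (S := S) b'
  have h1 := (hf.mvfderiv_apply (σ.vecRe_smooth x _ _ hb hb')).diffAt
  have h2 := (hf.mvfderiv_apply (σ.vecRe_smooth x _ _ hb.smul_I hb')).diffAt
  rw [h.vecRe_parallel x _ _ v hb.diffAt hb'.diffAt,
    h.vecRe_parallel x _ _ v hb.smul_I.diffAt hb'.diffAt, h.smul_I x _ v hb.diffAt]
  simp only [covDeriv, twist00, spinorForm, extend_apply_self]
  rw [mvfderiv_sub_apply h1 ((funDiffAt_const _).mul h2), mvfderiv_const_mul_apply _ h2]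
  simp only [map_add]
  ring

/-- `∇_{AA'} ∇_{BB'} f = ∇_{BB'} ∇_{AA'} f` for a scalar field `f`. -/
theorem del_twist00_symm (hD : D.torsion = 0) (h : IsSpinConnection σ D nab) {f : M → ℂ} {x : M}
    (hf : FunSmoothAt f x) (a a' b b' : S x) :
    σ.del nab (σ.twist00 f) x a a' b b' = σ.del nab (σ.twist00 f) x b b' a a' := by
  have hs := fun c : S x => spinSmoothAt_extend (S := S) c
  have h1 := fun c c' : S x => σ.vecRe_smooth x _ _ (hs c) (hs c')
  have h2 := fun c c' : S x => σ.vecRe_smooth x _ _ (hs c).smul_I (hs c')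
  -- Complexifying each vector argument doubles the terms, hence four real Hessian symmetries.
  have e1 := hessian_symm hD hf (h1 a a') (h1 b b')
  have e2 := hessian_symm hD hf (h1 a a') (h2 b b')
  have e3 := hessian_symm hD hf (h2 a a') (h1 b b')
  have e4 := hessian_symm hD hf (h2 a a') (h2 b b')
  simp only [extend_apply_self] at e1 e2 e3 e4
  simp only [del, spinorForm, covDeriv_twist00 h hf]
  linear_combination e1 - Complex.I * e2 - Complex.I * e3 + Complex.I ^ 2 * e4

end SpinorStructure

end Spin

/-! ### Contractions of spinor fields: smoothness and Leibniz rules. -/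

section Fields

variable {M : Type*} [TopologicalSpace M] [ChartedSpace R4 M] [IsManifold (𝓡 4) ∞ M]
  {S : M → Type*} [TopologicalSpace (TotalSpace C2 S)]
  [∀ x, AddCommGroup (S x)] [∀ x, Module ℂ (S x)] [∀ x, TopologicalSpace (S x)]
  [∀ x, IsTopologicalAddGroup (S x)] [∀ x, ContinuousSMul ℝ (S x)]
  [FiberBundle C2 S] [VectorBundle ℂ C2 S] [VectorBundle ℝ C2 S]
  [ContMDiffVectorBundle ∞ C2 S (𝓡 4)]
  {g : LorentzMetric M} {σ : SpinorStructure g S}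
  {D : CovariantDerivative (𝓡 4) R4 (TangentSpace (𝓡 4) : M → Type _)}
  {nab : CovariantDerivative (𝓡 4) C2 S}

theorem SymSpinor.isSesquilinearField (φ : SymSpinor S) :
    IsSesquilinearField (RingHom.id ℂ) φ.comp where
  real _ := rfl
  left y d := ⟨fun s t => by simp [SymSpinor.comp], fun z s => by simp [SymSpinor.comp]⟩
  right y c := ⟨fun s t => by simp [SymSpinor.comp], fun z s => by simp [SymSpinor.comp]⟩

theorem SymSpinor.fieldSmoothAt (φ : SymSpinor S) (x : M) : FieldSmoothAt φ.comp x :=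
  fun s t hs ht => φ.smooth x s t hs ht

/-- Contractions are defined by frames chosen separately at every point, with no continuity. They
are shown smooth after multiplication by `ε` of two smooth sections, which is nonzero nearby. -/
theorem FunSmoothAt.of_mul_eq {f e h : M → ℂ} {x : M} (he : FunSmoothAt e x) (hx : e x ≠ 0)
    (hh : FunSmoothAt h x) (H : ∀ y, f y * e y = h y) : FunSmoothAt f x := by
  refine (hh.mul (he.inv hx)).congr_of_eventuallyEq ?_
  filter_upwards [(ContMDiffAt.continuousAt he).eventually_ne hx] with y hy
  rw [← H y, mul_assoc, mul_inv_cancel₀ hy, mul_one]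

theorem covDeriv_swap (nab : CovariantDerivative (𝓡 4) C2 S) (B : ∀ y : M, S y → S y → ℂ) (x : M)
    (c d : S x) (v : TangentSpace (𝓡 4) x) :
    covDeriv nab (fun y a b => B y b a) x c d v = covDeriv nab B x d c v := by
  unfold covDeriv; ring

theorem SymSpinor.covDeriv_symm (φ : SymSpinor S) (x : M)
    (c d : S x) (v : TangentSpace (𝓡 4) x) :
    covDeriv nab φ.comp x c d v = covDeriv nab φ.comp x d c v := by
  have h : φ.comp = fun y a b => φ.comp y b a := by
    funext y a b; exact φ.symm y a b
  conv_lhs => rw [h, covDeriv_swap]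

namespace SpinorStructure

variable (σ) in
/-- The contraction `φ_{AD} ψ_B^D`. -/
def contr (φ ψ : ∀ y : M, S y → S y → ℂ) (x : M) (a b : S x) : ℂ :=
  σ.up x fun d f => φ x a d * ψ x b f

theorem eps_smooth_extend {x : M} (o ι : S x) :
    FunSmoothAt (fun y => σ.eps y (extend C2 o y) (extend C2 ι y)) x :=
  σ.eps_smooth x _ _ (spinSmoothAt_extend o) (spinSmoothAt_extend ι)

/-- This trades the chosen frame for arbitrary arguments, into which smooth sections can be
inserted. -/
theorem up_mul_eps {B : ∀ y : M, S y → S y → ℂ} (hB : IsSesquilinearField (RingHom.id ℂ) B)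
    (y : M) (a c : S y) : σ.up y (B y) * σ.eps y a c = B y a c - B y c a := by
  rw [σ.antisymm_eq (hB.left y) (hB.right y)]; simp [mul_comm]

theorem up_smooth {B : ∀ y : M, S y → S y → ℂ} (hB : IsSesquilinearField (RingHom.id ℂ) B) {x : M}
    (hs : FieldSmoothAt B x) : FunSmoothAt (fun y => σ.up y (B y)) x := by
  have ho := spinSmoothAt_extend (σ.frameO x)
  have hι := spinSmoothAt_extend (σ.frameI x)
  exact FunSmoothAt.of_mul_eq (σ.eps_smooth x _ _ ho hι) (by simp [σ.eps_frame])
    ((hs _ _ ho hι).sub (hs _ _ hι ho)) fun y => up_mul_eps hB y _ _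

/-- Differentiate `up_mul_eps` along extensions of the frame at `x`. As `ε` is parallel, the terms
containing derivatives of the sections cancel by the same identity at `x`. -/
theorem mvfderiv_up (h : IsSpinConnection σ D nab) {B : ∀ y : M, S y → S y → ℂ}
    (hB : IsSesquilinearField (RingHom.id ℂ) B) {x : M} (hs : FieldSmoothAt B x)
    (v : TangentSpace (𝓡 4) x) :
    mvfderiv (𝓡 4) (fun y => σ.up y (B y)) x v
      = σ.up x fun a b => covDeriv nab B x a b v := by
  set o := σ.frameO x with ho
  set ι := σ.frameI x with hι
  have h0 : σ.eps x o ι = 1 := σ.eps_frame x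
  have e : (fun y => σ.up y (B y) * σ.eps y (extend C2 o y) (extend C2 ι y))
      = fun y => B y (extend C2 o y) (extend C2 ι y) - B y (extend C2 ι y) (extend C2 o y) :=
    funext fun y => up_mul_eps hB y _ _
  have e' := congrArg (fun f => mvfderiv (𝓡 4) f x v) e
  beta_reduce at e'
  rw [mvfderiv_mul_apply (up_smooth hB hs).diffAt (eps_smooth_extend o ι).diffAt,
    mvfderiv_sub_apply (hs.diffAt_extend o ι) (hs.diffAt_extend ι o), h.mvfderiv_eps,
    mvfderiv_extend nab, mvfderiv_extend nab] at e'
  simp only [extend_apply_self, h0] at e'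
  have e1 := up_mul_eps (σ := σ) hB x (nab (extend C2 o) x v) ι
  have e2 := up_mul_eps (σ := σ) hB x o (nab (extend C2 ι) x v)
  change _ = covDeriv nab B x o ι v - covDeriv nab B x ι o v
  linear_combination e' - e1 - e2

variable {φ ψ : ∀ y : M, S y → S y → ℂ}

theorem contr_mul_eps (hφ : IsSesquilinearField (RingHom.id ℂ) φ)
    (hψ : IsSesquilinearField (RingHom.id ℂ) ψ) (y : M) (a b c d : S y) :
    σ.contr φ ψ y a b * σ.eps y c d = φ y a c * ψ y b d - φ y a d * ψ y b c := by
  unfold contr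
  rw [σ.antisymm_eq (x := y) (τ := RingHom.id ℂ) (G := fun d f => φ y a d * ψ y b f)
    (fun t => ⟨fun s t => by rw [(hφ.right y a).add]; ring,
      fun z s => by rw [(hφ.right y a).smul]; ring⟩)
    (fun t => ⟨fun s t => by rw [(hψ.right y b).add]; ring,
      fun z s => by rw [(hψ.right y b).smul]; ring⟩)]
  simp [mul_comm]

theorem contr_isSesquilinearField (hφ : IsSesquilinearField (RingHom.id ℂ) φ)
    (hψ : IsSesquilinearField (RingHom.id ℂ) ψ) :
    IsSesquilinearField (RingHom.id ℂ) (σ.contr φ ψ) where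
  real _ := rfl
  left y d := ⟨fun s t => by simp only [contr, up, (hφ.left y _).add]; ring,
    fun z s => by simp only [contr, up, (hφ.left y _).smul]; ring⟩
  right y c := ⟨fun s t => by simp only [contr, up, (hψ.left y _).add]; ring,
    fun z s => by simp only [contr, up, (hψ.left y _).smul]; ring⟩

theorem contr_smooth (hφ : IsSesquilinearField (RingHom.id ℂ) φ)
    (hψ : IsSesquilinearField (RingHom.id ℂ) ψ) {x : M} (hφs : FieldSmoothAt φ x)
    (hψs : FieldSmoothAt ψ x) : FieldSmoothAt (σ.contr φ ψ) x := by
  intro s t hs ht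
  have ho := spinSmoothAt_extend (σ.frameO x)
  have hι := spinSmoothAt_extend (σ.frameI x)
  exact FunSmoothAt.of_mul_eq (σ.eps_smooth x _ _ ho hι) (by simp [σ.eps_frame])
    (((hφs _ _ hs ho).mul (hψs _ _ ht hι)).sub ((hφs _ _ hs hι).mul (hψs _ _ ht ho)))
    fun y => contr_mul_eps hφ hψ y _ _ _ _

theorem covDeriv_contr (h : IsSpinConnection σ D nab) (hφ : IsSesquilinearField (RingHom.id ℂ) φ)
    (hψ : IsSesquilinearField (RingHom.id ℂ) ψ) {x : M} (hφs : FieldSmoothAt φ x)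
    (hψs : FieldSmoothAt ψ x) (a b : S x) (v : TangentSpace (𝓡 4) x) :
    covDeriv nab (σ.contr φ ψ) x a b v
      = σ.up x fun d f => covDeriv nab φ x a d v * ψ x b f + φ x a d * covDeriv nab ψ x b f v := by
  set o := σ.frameO x with ho
  set ι := σ.frameI x with hι
  have h0 : σ.eps x o ι = 1 := σ.eps_frame x
  have e : (fun y => σ.contr φ ψ y (extend C2 a y) (extend C2 b y)
        * σ.eps y (extend C2 o y) (extend C2 ι y))
      = fun y => φ y (extend C2 a y) (extend C2 o y) * ψ y (extend C2 b y) (extend C2 ι y)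
        - φ y (extend C2 a y) (extend C2 ι y) * ψ y (extend C2 b y) (extend C2 o y) :=
    funext fun y => contr_mul_eps hφ hψ y _ _ _ _
  have e' := congrArg (fun f => mvfderiv (𝓡 4) f x v) e
  beta_reduce at e'
  have hc := contr_smooth (σ := σ) hφ hψ hφs hψs
  rw [mvfderiv_mul_apply (hc.diffAt_extend a b) (eps_smooth_extend o ι).diffAt,
    mvfderiv_sub_apply ((hφs.diffAt_extend a o).mul (hψs.diffAt_extend b ι))
      ((hφs.diffAt_extend a ι).mul (hψs.diffAt_extend b o)),
    mvfderiv_mul_apply (hφs.diffAt_extend a o) (hψs.diffAt_extend b ι),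
    mvfderiv_mul_apply (hφs.diffAt_extend a ι) (hψs.diffAt_extend b o), h.mvfderiv_eps] at e'
  simp only [mvfderiv_extend nab, extend_apply_self, h0] at e'
  -- One undifferentiated identity for each of the four sections removes its connection term.
  have e1 := contr_mul_eps (σ := σ) hφ hψ x (nab (extend C2 a) x v) b o ι
  have e2 := contr_mul_eps (σ := σ) hφ hψ x a (nab (extend C2 b) x v) o ι
  have e3 := contr_mul_eps (σ := σ) hφ hψ x a b (nab (extend C2 o) x v) ι
  have e4 := contr_mul_eps (σ := σ) hφ hψ x a b o (nab (extend C2 ι) x v)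
  rw [h0] at e1 e2
  change _ = (covDeriv nab φ x a o v * ψ x b ι + φ x a o * covDeriv nab ψ x b ι v)
    - (covDeriv nab φ x a ι v * ψ x b o + φ x a ι * covDeriv nab ψ x b o v)
  linear_combination e' - e1 - e2 - e3 - e4

theorem twist00_up (h : IsSpinConnection σ D nab) {B : ∀ y : M, S y → S y → ℂ}
    (hB : IsSesquilinearField (RingHom.id ℂ) B) {x : M} (hs : FieldSmoothAt B x) (c c' : S x) :
    σ.twist00 (fun y => σ.up y (B y)) x c c' = σ.up x fun a b => σ.del nab B x c c' a b := by
  simp only [twist00, del, spinorForm, mvfderiv_up h hB hs]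
  simp only [up]
  ring

theorem del_contr (h : IsSpinConnection σ D nab) (hφ : IsSesquilinearField (RingHom.id ℂ) φ)
    (hψ : IsSesquilinearField (RingHom.id ℂ) ψ) {x : M} (hφs : FieldSmoothAt φ x)
    (hψs : FieldSmoothAt ψ x) (c c' a b : S x) :
    σ.del nab (σ.contr φ ψ) x c c' a b
      = σ.up x fun d f => σ.del nab φ x c c' a d * ψ x b f + φ x a d * σ.del nab ψ x c c' b f := by
  simp only [del, spinorForm, covDeriv_contr h hφ hψ hφs hψs, up]
  ring

theorem del_symm (φ : SymSpinor S) (x : M) (a a' c d : S x) :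
    σ.del nab φ.comp x a a' c d = σ.del nab φ.comp x a a' d c := by
  simp only [del, spinorForm, φ.covDeriv_symm x c d]

theorem inner20_eq_up (φ ψ : ∀ y : M, S y → S y → ℂ) :
    σ.inner20 φ ψ = fun y => σ.up y (σ.contr φ ψ y) := rfl

theorem inner20_smooth (φ ψ : SymSpinor S) (x : M) :
    FunSmoothAt (σ.inner20 φ.comp ψ.comp) x := by
  rw [inner20_eq_up]
  exact up_smooth (contr_isSesquilinearField φ.isSesquilinearField ψ.isSesquilinearField)
    (contr_smooth φ.isSesquilinearField ψ.isSesquilinearField (φ.fieldSmoothAt x)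
      (ψ.fieldSmoothAt x))

theorem twist00_inner20 (h : IsSpinConnection σ D nab) (φ ψ : SymSpinor S) (x : M) (c c' : S x) :
    σ.twist00 (σ.inner20 φ.comp ψ.comp) x c c'
      = σ.up x fun a b => σ.up x fun d f =>
        σ.del nab φ.comp x c c' a d * ψ.comp x b f
          + φ.comp x a d * σ.del nab ψ.comp x c c' b f := by
  have hφ := φ.isSesquilinearField
  have hψ := ψ.isSesquilinearField
  rw [inner20_eq_up, twist00_up h (contr_isSesquilinearField hφ hψ)
    (contr_smooth hφ hψ (φ.fieldSmoothAt x) (ψ.fieldSmoothAt x))]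
  simp only [del_contr h hφ hψ (φ.fieldSmoothAt x) (ψ.fieldSmoothAt x)]

/-! ### The fields `Θ`, `U`, `β` and the first formula for `β`. -/

theorem Theta_eq (κ φ : SymSpinor S) :
    σ.Theta κ φ = fun x a b => -(σ.contr φ.comp κ.comp x b a + σ.contr φ.comp κ.comp x a b) := by
  funext x a b
  simp only [Theta, contr, up]
  ring

theorem Theta_symm (κ φ : SymSpinor S) (x : M) (a b : S x) :
    σ.Theta κ φ x a b = σ.Theta κ φ x b a := by
  simp only [Theta_eq]; ring

theorem Theta_isSesquilinearField (κ φ : SymSpinor S) :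
    IsSesquilinearField (RingHom.id ℂ) (σ.Theta κ φ) := by
  have hc := contr_isSesquilinearField (σ := σ) φ.isSesquilinearField κ.isSesquilinearField
  rw [Theta_eq]
  exact ⟨fun _ => rfl,
    fun y d => ⟨fun s t => by rw [(hc.left y d).add, (hc.right y d).add]; ring,
      fun z s => by rw [(hc.left y d).smul, (hc.right y d).smul]; ring⟩,
    fun y d => ⟨fun s t => by rw [(hc.left y d).add, (hc.right y d).add]; ring,
      fun z s => by rw [(hc.left y d).smul, (hc.right y d).smul]; ring⟩⟩

theorem Theta_smooth (κ φ : SymSpinor S) (x : M) : FieldSmoothAt (σ.Theta κ φ) x := by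
  have hc := contr_smooth (σ := σ) φ.isSesquilinearField κ.isSesquilinearField (φ.fieldSmoothAt x)
    (κ.fieldSmoothAt x)
  rw [Theta_eq]
  intro s t hs ht
  exact ((hc _ _ ht hs).add (hc _ _ hs ht)).neg

theorem del_Theta (κ φ : SymSpinor S) (x : M) (c c' a b : S x) :
    σ.del nab (σ.Theta κ φ) x c c' a b
      = -(σ.del nab (σ.contr φ.comp κ.comp) x c c' b a
        + σ.del nab (σ.contr φ.comp κ.comp) x c c' a b) := by
  have hc := contr_smooth (σ := σ) φ.isSesquilinearField κ.isSesquilinearField (φ.fieldSmoothAt x)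
    (κ.fieldSmoothAt x)
  have key : ∀ v, covDeriv nab (σ.Theta κ φ) x a b v
      = -(covDeriv nab (σ.contr φ.comp κ.comp) x b a v
        + covDeriv nab (σ.contr φ.comp κ.comp) x a b v) := by
    intro v
    rw [Theta_eq]
    simp only [covDeriv]
    rw [mvfderiv_neg_apply, mvfderiv_add_apply (hc.diffAt_extend b a) (hc.diffAt_extend a b)]
    ring
  simp only [del, spinorForm, key]
  ring

theorem U_isSesquilinearField (κ : SymSpinor S) :
    IsSesquilinearField (starRingEnd ℂ) (σ.U κ) := by
  have hc := σ.twist00_isSesquilinearField fun y => -σ.inner20 κ.comp κ.comp y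
  exact ⟨hc.real, fun y d => ⟨fun s t => by simp only [U, (hc.left y d).add]; ring,
      fun z s => by simp only [U, (hc.left y d).smul]; ring⟩,
    fun y d => ⟨fun s t => by simp only [U, (hc.right y d).add]; ring,
      fun z s => by simp only [U, (hc.right y d).smul]; ring⟩⟩

theorem twist00_neg (f : M → ℂ) (x : M) (a a' : S x) :
    σ.twist00 (fun y => -f y) x a a' = -σ.twist00 f x a a' := by
  simp only [twist00, spinorForm, mvfderiv_neg_apply]; ring

theorem beta_isSemilinear_left (h : IsSpinConnection σ D nab) (κ φ : SymSpinor S) (x : M)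
    (a' : S x) : IsSemilinear (RingHom.id ℂ) fun a => σ.beta nab κ φ x a a' := by
  have hd := fun c b => del_isSemilinear₃ h (Theta_isSesquilinearField (σ := σ) κ φ)
    (Theta_smooth κ φ x) c a' b
  have hΘ := (Theta_isSesquilinearField (σ := σ) κ φ).left x
  exact ⟨fun s t => by
      simp only [beta, curlDagger20, up, (hd _ _).add, (hΘ _).add]; ring,
    fun z s => by
      simp only [beta, curlDagger20, up, (hd _ _).smul, (hΘ _).smul, RingHom.id_apply]; ring⟩

/-- Everything is expanded in one spin frame. After the field equations are substituted, a rational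
identity in the components of `κ`, `φ` and their derivatives remains. -/
theorem beta_eq (h : IsSpinConnection σ D nab) {κ φ : SymSpinor S} (hκ : σ.IsKillingSpinor nab κ)
    (hκ0 : ∀ x, σ.inner20 κ.comp κ.comp x ≠ 0) (hφ : σ.IsMaxwell nab φ) (x : M) (a a' : S x) :
    σ.beta nab κ φ x a a'
      = -σ.U κ x a a' * σ.Upsilon κ φ x + σ.twist00 (σ.Upsilon κ φ) x a a' := by
  have h0 := σ.eps_frame x
  have hU := (U_isSesquilinearField (σ := σ) κ).left x a'
  have hT := (σ.twist00_isSesquilinearField (σ.Upsilon κ φ)).left x a'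
  have hR : IsSemilinear (RingHom.id ℂ) fun a =>
      -σ.U κ x a a' * σ.Upsilon κ φ x + σ.twist00 (σ.Upsilon κ φ) x a a' :=
    ⟨fun s t => by simp only [hU.add, hT.add]; ring,
      fun z s => by simp only [hU.smul, hT.smul]; ring⟩
  have hκ1 := hκ x (σ.frameO x) (σ.frameO x) (σ.frameO x) a'
  have hκ2 := hκ x (σ.frameO x) (σ.frameO x) (σ.frameI x) a'
  have hκ3 := hκ x (σ.frameO x) (σ.frameI x) (σ.frameI x) a'
  have hκ4 := hκ x (σ.frameI x) (σ.frameI x) (σ.frameI x) a'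
  have hφ1 := hφ x (σ.frameO x) a'
  have hφ2 := hφ x (σ.frameI x) a'
  have hF := hκ0 x
  have hκs := fun a b => κ.symm x a b
  have hE : (fun y => -σ.inner20 κ.comp κ.comp y) = fun y => -(σ.inner20 κ.comp κ.comp) y := rfl
  -- Both sides are complex linear in `a`, so they are expanded in their values at the two frame
  -- vectors.
  rw [(beta_isSemilinear_left h κ φ x a').eq_frame σ h0 a, hR.eq_frame σ h0 a]
  have hΥ : σ.Upsilon κ φ = σ.inner20 φ.comp κ.comp := rfl
  simp only [beta, curlDagger20, del_Theta, U, twist00_neg, hΥ, twist00_inner20 h,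
    del_contr h φ.isSesquilinearField κ.isSesquilinearField (φ.fieldSmoothAt x)
      (κ.fieldSmoothAt x), Theta]
  have e1 : κ.comp x (σ.frameI x) (σ.frameO x) = κ.comp x (σ.frameO x) (σ.frameI x) := κ.symm x _ _
  have e2 : φ.comp x (σ.frameI x) (σ.frameO x) = φ.comp x (σ.frameO x) (σ.frameI x) := φ.symm x _ _
  have e3 := fun c => del_symm (σ := σ) (nab := nab) κ x c a' (σ.frameI x) (σ.frameO x)
  have e4 := fun c => del_symm (σ := σ) (nab := nab) φ x c a' (σ.frameI x) (σ.frameO x)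
  simp only [twist20, curlDagger20, up, inner20, e1, e2, e3, e4] at hκ1 hκ2 hκ3 hκ4 hφ1 hφ2 hF ⊢
  generalize σ.eps x a (σ.frameI x) = α
  generalize σ.eps x (σ.frameO x) a = α'
  generalize σ.frameO x = o at *
  generalize σ.frameI x = ι at *
  generalize κ.comp x o o = k0 at *
  generalize κ.comp x o ι = k1 at *
  generalize κ.comp x ι ι = k2 at *
  generalize φ.comp x o o = f0 at *
  generalize φ.comp x o ι = f1 at *
  generalize φ.comp x ι ι = f2 at *
  -- The Killing equation expresses all components of `∇κ` with this `a'` through the two with last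
  -- indices `o ι`.
  have i1 : σ.del nab κ.comp x o a' o o = 0 := by linear_combination hκ1
  have i2 : σ.del nab κ.comp x ι a' o o = -2 * σ.del nab κ.comp x o a' o ι := by
    linear_combination 3 * hκ2
  have i3 : σ.del nab κ.comp x o a' ι ι = -2 * σ.del nab κ.comp x ι a' o ι := by
    linear_combination 3 * hκ3
  have i4 : σ.del nab κ.comp x ι a' ι ι = 0 := by linear_combination hκ4
  -- Maxwell's equation: `∇φ` is symmetric in its three unprimed indices.
  have j1 : σ.del nab φ.comp x ι a' o o = σ.del nab φ.comp x o a' o ι := by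
    linear_combination hφ1
  have j2 : σ.del nab φ.comp x ι a' o ι = σ.del nab φ.comp x o a' ι ι := by
    linear_combination hφ2
  simp only [i1, i2, i3, i4, j1, j2]
  clear i1 i2 i3 i4 j1 j2 hκ1 hκ2 hκ3 hκ4 hφ1 hφ2
  generalize σ.del nab κ.comp x o a' o ι = K1
  generalize σ.del nab κ.comp x ι a' o ι = K2
  -- `κ_{CD} κ^{CD}` is twice the determinant of the component matrix of `κ`.
  have hF' : k0 * k2 - k1 ^ 2 ≠ 0 := fun h => hF (by linear_combination 2 * h)
  have hF2 : k0 * k2 - k1 * k1 - (k1 * k1 - k2 * k0) = 2 * (k0 * k2 - k1 ^ 2) := by ring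
  simp only [hF2]
  field_simp
  ring

/-! ### Closedness of `U` and the two curl equations. -/

variable {x : M}

theorem del_add {A B : ∀ y : M, S y → S y → ℂ} (hA : FieldSmoothAt A x) (hB : FieldSmoothAt B x)
    (a a' b b' : S x) :
    σ.del nab (fun y c d => A y c d + B y c d) x a a' b b'
      = σ.del nab A x a a' b b' + σ.del nab B x a a' b b' := by
  have key : ∀ v, covDeriv nab (fun y c d => A y c d + B y c d) x b b' v
      = covDeriv nab A x b b' v + covDeriv nab B x b b' v := by
    intro v
    simp only [covDeriv]
    rw [mvfderiv_add_apply (hA.diffAt_extend b b') (hB.diffAt_extend b b')]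
    ring
  simp only [del, spinorForm, key]
  ring

theorem del_smul {f : M → ℂ} {B : ∀ y : M, S y → S y → ℂ} (hf : FunSmoothAt f x)
    (hB : FieldSmoothAt B x) (a a' b b' : S x) :
    σ.del nab (fun y c d => f y * B y c d) x a a' b b'
      = σ.twist00 f x a a' * B x b b' + f x * σ.del nab B x a a' b b' := by
  have key : ∀ v, covDeriv nab (fun y c d => f y * B y c d) x b b' v
      = mvfderiv (𝓡 4) f x v * B x b b' + f x * covDeriv nab B x b b' v := by
    intro v
    simp only [covDeriv]
    rw [mvfderiv_mul_apply hf.diffAt (hB.diffAt_extend b b')]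
    simp only [extend_apply_self]
    ring
  simp only [del, spinorForm, twist00, key]
  ring

theorem _root_.KillingSpinorMaxwell.FieldSmoothAt.smul {f : M → ℂ} {B : ∀ y : M, S y → S y → ℂ}
    (hf : FunSmoothAt f x) (hB : FieldSmoothAt B x) :
    FieldSmoothAt (fun y c d => f y * B y c d) x :=
  fun s t hs ht => hf.mul (hB s t hs ht)

theorem _root_.KillingSpinorMaxwell.FieldSmoothAt.add {A B : ∀ y : M, S y → S y → ℂ}
    (hA : FieldSmoothAt A x) (hB : FieldSmoothAt B x) :
    FieldSmoothAt (fun y c d => A y c d + B y c d) x :=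
  fun s t hs ht => (hA s t hs ht).add (hB s t hs ht)

theorem U_eq (κ : SymSpinor S) :
    σ.U κ = fun y a b => (-(1 / 2) * (-σ.inner20 κ.comp κ.comp y)⁻¹)
      * σ.twist00 (fun y => -σ.inner20 κ.comp κ.comp y) y a b := by
  funext y a b
  unfold U; ring

theorem U_smooth {κ : SymSpinor S} (hκ0 : ∀ x, σ.inner20 κ.comp κ.comp x ≠ 0) (x : M) :
    FieldSmoothAt (σ.U κ) x := by
  have hF := (inner20_smooth (σ := σ) κ κ x).neg
  rw [U_eq]
  exact FieldSmoothAt.smul ((funSmoothAt_const _).mul (hF.inv (neg_ne_zero.2 (hκ0 x))))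
    (σ.twist00_smooth hF)

/-- The covector field `U` is closed. -/
theorem del_U_symm (hD : D.torsion = 0) (h : IsSpinConnection σ D nab) {κ : SymSpinor S}
    (hκ0 : ∀ x, σ.inner20 κ.comp κ.comp x ≠ 0) (x : M) (a a' b b' : S x) :
    σ.del nab (σ.U κ) x a a' b b' = σ.del nab (σ.U κ) x b b' a a' := by
  have hF := (inner20_smooth (σ := σ) κ κ x).neg
  have h0 := neg_ne_zero.2 (hκ0 x)
  have hi := hF.inv h0
  -- No logarithm is used: `U` is a function of `F` times `dF`, so its derivative is a multiple of
  -- `dF ⊗ dF` plus a multiple of the Hessian of `F`, both symmetric.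
  have key : ∀ c c' : S x, σ.twist00 (fun y => -(1 / 2) * (-σ.inner20 κ.comp κ.comp y)⁻¹) x c c'
      = (1 / 2) * σ.twist00 (fun y => -σ.inner20 κ.comp κ.comp y) x c c'
        / (-σ.inner20 κ.comp κ.comp x) ^ 2 := by
    intro c c'
    simp only [twist00, spinorForm]
    rw [mvfderiv_const_mul_apply _ hi.diffAt, mvfderiv_const_mul_apply _ hi.diffAt,
      mvfderiv_inv_apply hF.diffAt h0, mvfderiv_inv_apply hF.diffAt h0]
    ring
  rw [U_eq, del_smul ((funSmoothAt_const _).mul hi) (σ.twist00_smooth hF),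
    del_smul ((funSmoothAt_const _).mul hi) (σ.twist00_smooth hF), key, key,
    del_twist00_symm hD h hF]
  ring

theorem beta_eq_fun (h : IsSpinConnection σ D nab) {κ φ : SymSpinor S}
    (hκ : σ.IsKillingSpinor nab κ) (hκ0 : ∀ x, σ.inner20 κ.comp κ.comp x ≠ 0)
    (hφ : σ.IsMaxwell nab φ) :
    σ.beta nab κ φ = fun y a a' => (-σ.Upsilon κ φ y) * σ.U κ y a a'
      + σ.twist00 (σ.Upsilon κ φ) y a a' := by
  funext y a a'
  rw [beta_eq h hκ hκ0 hφ]; ring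

theorem beta_smooth (h : IsSpinConnection σ D nab) {κ φ : SymSpinor S}
    (hκ : σ.IsKillingSpinor nab κ) (hκ0 : ∀ x, σ.inner20 κ.comp κ.comp x ≠ 0)
    (hφ : σ.IsMaxwell nab φ) (x : M) : FieldSmoothAt (σ.beta nab κ φ) x := by
  have hΥ : FunSmoothAt (σ.Upsilon κ φ) x := inner20_smooth φ κ x
  rw [beta_eq_fun h hκ hκ0 hφ]
  exact FieldSmoothAt.add (FieldSmoothAt.smul hΥ.neg (U_smooth hκ0 x)) (σ.twist00_smooth hΥ)

/-- `dβ = U ∧ β`. -/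
theorem del_beta_antisymm (hD : D.torsion = 0) (h : IsSpinConnection σ D nab) {κ φ : SymSpinor S}
    (hκ : σ.IsKillingSpinor nab κ) (hκ0 : ∀ x, σ.inner20 κ.comp κ.comp x ≠ 0)
    (hφ : σ.IsMaxwell nab φ) (x : M) (a a' b b' : S x) :
    σ.del nab (σ.beta nab κ φ) x a a' b b' - σ.del nab (σ.beta nab κ φ) x b b' a a'
      = σ.U κ x a a' * σ.beta nab κ φ x b b' - σ.U κ x b b' * σ.beta nab κ φ x a a' := by
  have hΥ : FunSmoothAt (σ.Upsilon κ φ) x := inner20_smooth φ κ x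
  have hU := U_smooth (σ := σ) hκ0 x
  have hT := σ.twist00_smooth hΥ
  have key : ∀ c c' d d' : S x, σ.del nab (σ.beta nab κ φ) x c c' d d'
      = -σ.twist00 (σ.Upsilon κ φ) x c c' * σ.U κ x d d'
        - σ.Upsilon κ φ x * σ.del nab (σ.U κ) x c c' d d'
        + σ.del nab (σ.twist00 (σ.Upsilon κ φ)) x c c' d d' := by
    intro c c' d d'
    rw [beta_eq_fun h hκ hκ0 hφ, del_add (FieldSmoothAt.smul hΥ.neg hU) hT, del_smul hΥ.neg hU,
      twist00_neg]
    ring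
  -- Only `-dΥ ∧ U` survives; adding the multiple `Υ U` to `β` does not change `U ∧ β`.
  rw [key, key, del_U_symm hD h hκ0 x b b' a a', del_twist00_symm hD h hΥ b b' a a',
    beta_eq h hκ hκ0 hφ, beta_eq h hκ hκ0 hφ]
  ring

/-- Contracting `dβ = U ∧ β` over the primed indices leaves the part symmetric in the unprimed ones.
-/
theorem curl11_beta (hD : D.torsion = 0) (h : IsSpinConnection σ D nab) {κ φ : SymSpinor S}
    (hκ : σ.IsKillingSpinor nab κ) (hκ0 : ∀ x, σ.inner20 κ.comp κ.comp x ≠ 0)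
    (hφ : σ.IsMaxwell nab φ) (x : M) (a b : S x) :
    σ.curl11 nab (σ.beta nab κ φ) x a b
      = (1 / 2) * ((σ.up x fun a' b' => σ.U κ x a b' * σ.beta nab κ φ x b a')
        + σ.up x fun a' b' => σ.U κ x b b' * σ.beta nab κ φ x a a') := by
  have e1 := del_beta_antisymm hD h hκ hκ0 hφ x a (σ.frameI x) b (σ.frameO x)
  have e2 := del_beta_antisymm hD h hκ hκ0 hφ x b (σ.frameI x) a (σ.frameO x)
  simp only [curl11, up]
  linear_combination (1 / 2) * (e1 + e2)

/-- The complementary part of the same two-form identity, contracted over the unprimed indices. -/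
theorem curlDagger11_beta (hD : D.torsion = 0) (h : IsSpinConnection σ D nab) {κ φ : SymSpinor S}
    (hκ : σ.IsKillingSpinor nab κ) (hκ0 : ∀ x, σ.inner20 κ.comp κ.comp x ≠ 0)
    (hφ : σ.IsMaxwell nab φ) (x : M) (a' b' : S x) :
    σ.curlDagger11 nab (σ.beta nab κ φ) x a' b'
      = (1 / 2) * ((σ.up x fun a b => σ.U κ x b a' * σ.beta nab κ φ x a b')
        + σ.up x fun a b => σ.U κ x b b' * σ.beta nab κ φ x a a') := by
  have e1 := del_beta_antisymm hD h hκ hκ0 hφ x (σ.frameI x) a' (σ.frameO x) b'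
  have e2 := del_beta_antisymm hD h hκ hκ0 hφ x (σ.frameI x) b' (σ.frameO x) a'
  simp only [curlDagger11, up]
  linear_combination (1 / 2) * (e1 + e2)

end SpinorStructure

/-! ### The divergence of `β` by twisted exterior calculus. -/

theorem mvfderiv_mul₃_apply {p q r : M → ℂ} {x : M} (hp : FunDiffAt p x) (hq : FunDiffAt q x)
    (hr : FunDiffAt r x) (v : TangentSpace (𝓡 4) x) :
    mvfderiv (𝓡 4) (fun y => p y * q y * r y) x v
      = mvfderiv (𝓡 4) p x v * q x * r x + p x * mvfderiv (𝓡 4) q x v * r x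
        + p x * q x * mvfderiv (𝓡 4) r x v := by
  rw [mvfderiv_mul_apply (hp.mul hq) hr, mvfderiv_mul_apply hp hq]; ring

namespace SpinorStructure

variable {J : Type*} [Fintype J] {f p q : J → M → ℂ} {x : M}

theorem del_symm_of_symm {Θ : ∀ y : M, S y → S y → ℂ} (hΘ : ∀ y a b, Θ y a b = Θ y b a)
    (a a' b c : S x) : σ.del nab Θ x a a' b c = σ.del nab Θ x a a' c b := by
  have key : ∀ v, covDeriv nab Θ x b c v = covDeriv nab Θ x c b v := by
    intro v
    have h : Θ = fun y a b => Θ y b a := by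
      funext y a b; exact hΘ y a b
    conv_lhs => rw [h, covDeriv_swap]
  simp only [del, spinorForm, key]

/-- The Leibniz rule for `Θ_{BC} ε̄_{B'C'} = ∑ f (p_{BB'} q_{CC'} - q_{BB'} p_{CC'})`, where
`p_{AA'}` and `q_{AA'}` are gradients. -/
theorem covDeriv_of_decomp (h : IsSpinConnection σ D nab) {Θ : ∀ y : M, S y → S y → ℂ}
    (hΘs : FieldSmoothAt Θ x)
    (hf : ∀ j, FunSmoothAt (f j) x) (hp : ∀ j, FunSmoothAt (p j) x) (hq : ∀ j, FunSmoothAt (q j) x)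
    (hdec : ∀ᶠ y in nhds x, ∀ b b' c c' : S y, Θ y b c * conj (σ.eps y b' c')
      = ∑ j, (f j y * σ.twist00 (p j) y b b' * σ.twist00 (q j) y c c'
        - f j y * σ.twist00 (q j) y b b' * σ.twist00 (p j) y c c'))
    (b b' c c' : S x) (v : TangentSpace (𝓡 4) x) :
    covDeriv nab Θ x b c v * conj (σ.eps x b' c')
      = ∑ j, (mvfderiv (𝓡 4) (f j) x v * (σ.twist00 (p j) x b b' * σ.twist00 (q j) x c c'
          - σ.twist00 (q j) x b b' * σ.twist00 (p j) x c c')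
        + f j x * (covDeriv nab (σ.twist00 (p j)) x b b' v * σ.twist00 (q j) x c c'
          + σ.twist00 (p j) x b b' * covDeriv nab (σ.twist00 (q j)) x c c' v
          - covDeriv nab (σ.twist00 (q j)) x b b' v * σ.twist00 (p j) x c c'
          - σ.twist00 (q j) x b b' * covDeriv nab (σ.twist00 (p j)) x c c' v)) := by
  have hP := fun j b b' => (σ.twist00_smooth (hp j)).diffAt_extend (c := b) (d := b')
  have hQ := fun j b b' => (σ.twist00_smooth (hq j)).diffAt_extend (c := b) (d := b')
  have hF := fun j => (hf j).diffAt
  have hE : FunDiffAt (fun y => σ.eps y (extend C2 b' y) (extend C2 c' y)) x :=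
    (eps_smooth_extend b' c').diffAt
  have e : (fun y => Θ y (extend C2 b y) (extend C2 c y)
        * conj (σ.eps y (extend C2 b' y) (extend C2 c' y)))
      =ᶠ[nhds x] fun y => ∑ j, (f j y * σ.twist00 (p j) y (extend C2 b y) (extend C2 b' y)
          * σ.twist00 (q j) y (extend C2 c y) (extend C2 c' y)
        - f j y * σ.twist00 (q j) y (extend C2 b y) (extend C2 b' y)
          * σ.twist00 (p j) y (extend C2 c y) (extend C2 c' y)) := by
    filter_upwards [hdec] with y hy using hy _ _ _ _
  have e' := mvfderiv_congr e v
  rw [mvfderiv_mul_apply (hΘs.diffAt_extend b c) hE.conj, mvfderiv_conj_apply hE, h.mvfderiv_eps,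
    mvfderiv_sum_apply _ fun j _ => (((hF j).mul (hP j b b')).mul (hQ j c c')).sub
      (((hF j).mul (hQ j b b')).mul (hP j c c'))] at e'
  have hsub := fun j => mvfderiv_sub_apply (((hF j).mul (hP j b b')).mul (hQ j c c'))
      (((hF j).mul (hQ j b b')).mul (hP j c c')) v
  have h3 := fun j => mvfderiv_mul₃_apply (hF j) (hP j b b') (hQ j c c') v
  have h4 := fun j => mvfderiv_mul₃_apply (hF j) (hQ j b b') (hP j c c') v
  simp only [hsub, h3, h4, mvfderiv_extend nab, extend_apply_self, map_add] at e'
  -- The connection term of each slot is removed by the decomposition at `x`, with that argument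
  -- replaced by its derivative; `ε̄` is parallel.
  have d := hdec.self_of_nhds
  have d1 := d (nab (extend C2 b) x v) b' c c'
  have d2 := d b b' (nab (extend C2 c) x v) c'
  have d3 := d b (nab (extend C2 b') x v) c c'
  have d4 := d b b' c (nab (extend C2 c') x v)
  have E := congrArg₂ (· - ·) (congrArg₂ (· - ·) (congrArg₂ (· - ·) (congrArg₂ (· - ·) e' d1) d2)
    d3) d4
  simp only [← Finset.sum_sub_distrib] at E
  exact Eq.trans (by ring) (E.trans (Finset.sum_congr rfl fun j _ => by ring))

theorem del_of_decomp (h : IsSpinConnection σ D nab) {Θ : ∀ y : M, S y → S y → ℂ}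
    (hΘs : FieldSmoothAt Θ x)
    (hf : ∀ j, FunSmoothAt (f j) x) (hp : ∀ j, FunSmoothAt (p j) x) (hq : ∀ j, FunSmoothAt (q j) x)
    (hdec : ∀ᶠ y in nhds x, ∀ b b' c c' : S y, Θ y b c * conj (σ.eps y b' c')
      = ∑ j, (f j y * σ.twist00 (p j) y b b' * σ.twist00 (q j) y c c'
        - f j y * σ.twist00 (q j) y b b' * σ.twist00 (p j) y c c'))
    (a a' b b' c c' : S x) :
    σ.del nab Θ x a a' b c * conj (σ.eps x b' c')
      = ∑ j, (σ.twist00 (f j) x a a' * (σ.twist00 (p j) x b b' * σ.twist00 (q j) x c c'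
          - σ.twist00 (q j) x b b' * σ.twist00 (p j) x c c')
        + f j x * (σ.del nab (σ.twist00 (p j)) x a a' b b' * σ.twist00 (q j) x c c'
          + σ.twist00 (p j) x b b' * σ.del nab (σ.twist00 (q j)) x a a' c c'
          - σ.del nab (σ.twist00 (q j)) x a a' b b' * σ.twist00 (p j) x c c'
          - σ.twist00 (q j) x b b' * σ.del nab (σ.twist00 (p j)) x a a' c c')) := by
  have d := covDeriv_of_decomp h hΘs hf hp hq hdec b b' c c'
  have d1 := d (σ.vecRe x a a')
  have d2 := d (σ.vecRe x (Complex.I • a) a')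
  have E := congrArg₂ (· - ·) d1 (congrArg (fun z => Complex.I * z) d2)
  simp only [Finset.mul_sum, ← Finset.sum_sub_distrib] at E
  have e : ∀ j s s', σ.twist00 (f j) x s s' = mvfderiv (𝓡 4) (f j) x (σ.vecRe x s s')
    - Complex.I * mvfderiv (𝓡 4) (f j) x (σ.vecRe x (Complex.I • s) s') := fun _ _ _ => rfl
  exact Eq.trans (by simp only [del, spinorForm]; ring)
    (E.trans (Finset.sum_congr rfl fun j _ => by simp only [del, spinorForm, e]; ring))

/-- The `3 × 3` determinant of three covectors on three vectors of the form `a^A ā'^{A'}`. -/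
def det₃ {V : Type*} (P p q : V → V → ℂ) (a a' b b' c c' : V) : ℂ :=
  P a a' * (p b b' * q c c' - q b b' * p c c') + P b b' * (p c c' * q a a' - q c c' * p a a')
    + P c c' * (p a a' * q b b' - q a a' * p b b')

/-- `∇^B_{A'} Θ_{AB} + U^B_{A'} Θ_{AB}` -/
def twistedDiv (σ : SpinorStructure g S) (nab : CovariantDerivative (𝓡 4) C2 S)
    (U Θ : ∀ y : M, S y → S y → ℂ) (x : M) (a a' : S x) : ℂ :=
  σ.up x fun b c => σ.del nab Θ x c a' a b + U x c a' * Θ x a b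

/-- The exterior derivative of the two-form `Θ_{AB} ε̄_{A'B'}`, twisted by `U`, is dual to the
(twisted) divergence of `Θ`. -/
theorem twistedDiv_dual (hD : D.torsion = 0) (h : IsSpinConnection σ D nab)
    {Θ U : ∀ y : M, S y → S y → ℂ}
    (hΘ : IsSesquilinearField (RingHom.id ℂ) Θ) (hΘs : FieldSmoothAt Θ x)
    (hΘsymm : ∀ y a b, Θ y a b = Θ y b a) (hU : IsSesquilinearField (starRingEnd ℂ) U)
    (hf : ∀ j, FunSmoothAt (f j) x) (hp : ∀ j, FunSmoothAt (p j) x) (hq : ∀ j, FunSmoothAt (q j) x)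
    (hdec : ∀ᶠ y in nhds x, ∀ b b' c c' : S y, Θ y b c * conj (σ.eps y b' c')
      = ∑ j, (f j y * σ.twist00 (p j) y b b' * σ.twist00 (q j) y c c'
        - f j y * σ.twist00 (q j) y b b' * σ.twist00 (p j) y c c'))
    (a a' b b' c c' : S x) :
    conj (σ.eps x b' c') * σ.eps x c a * σ.twistedDiv nab U Θ x b a'
        + conj (σ.eps x c' a') * σ.eps x c b * σ.twistedDiv nab U Θ x a b'
      = ∑ j, det₃ (fun s s' => σ.twist00 (f j) x s s' + f j x * U x s s') (σ.twist00 (p j) x)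
        (σ.twist00 (q j) x) a a' b b' c c' := by
  set T : S x → S x → S x → S x → ℂ := fun a a' b c => σ.del nab Θ x a a' b c + U x a a' * Θ x b c
    with hT
  have hd1 := fun a' b c => σ.del_isSemilinear₁ (nab := nab) hΘ x a' b c
  have hd2 := fun a b c => σ.del_isSemilinear₂ (nab := nab) hΘ x a b c
  have hd4 := fun a a' b => del_isSemilinear₄ h hΘ hΘs a a' b
  have hT1 : ∀ a' b c, IsSemilinear (RingHom.id ℂ) fun a => T a a' b c := fun a' b c =>
    ⟨fun s t => by simp only [hT, (hd1 _ _ _).add, (hU.left x _).add]; ring,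
      fun z s => by simp only [hT, (hd1 _ _ _).smul, (hU.left x _).smul]; ring⟩
  have hT2 : ∀ a b c, IsSemilinear (starRingEnd ℂ) fun a' => T a a' b c := fun a b c =>
    ⟨fun s t => by simp only [hT, (hd2 _ _ _).add, (hU.right x _).add]; ring,
      fun z s => by simp only [hT, (hd2 _ _ _).smul, (hU.right x _).smul]; ring⟩
  have hT4 : ∀ a a' b, IsSemilinear (RingHom.id ℂ) fun c => T a a' b c := fun a a' b =>
    ⟨fun s t => by simp only [hT, (hd4 _ _ _).add, (hΘ.right x _).add]; ring,
      fun z s => by simp only [hT, (hd4 _ _ _).smul, (hΘ.right x _).smul, RingHom.id_apply]; ring⟩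
  have hTs : ∀ a a' b c, T a a' b c = T a a' c b := fun a a' b c => by
    simp only [hT, del_symm_of_symm hΘsymm a a' b c, hΘsymm x b c]
  -- Antisymmetry in two unprimed indices produces `ε` times a trace, and the trace is the twisted
  -- divergence.
  have key : ∀ a b c a' : S x, T a a' b c - T c a' b a
      = σ.eps x c a * σ.twistedDiv nab U Θ x b a' := by
    intro a b c a'
    have := σ.antisymm_eq (x := x) (τ := RingHom.id ℂ) (G := fun s t => T t a' b s)
      (fun t => hT4 t a' b) (fun s => hT1 a' b s) c a
    simpa [twistedDiv] using this
  have k1 := key a b c a'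
  have k2 := key b a c b'
  -- In the cyclic sum defining `d_U F`, this identity in the primed indices eliminates the `ε̄(a',
  -- b')` term and leaves the two differences of `key`.
  have hS := σ.schouten (τ := starRingEnd ℂ) (hT2 c a b) a' b' c'
  have hsum := fun a a' b b' c c' : S x => congrArg₂ (· + ·)
    (del_of_decomp h hΘs hf hp hq hdec a a' b b' c c')
    (congrArg (fun z => U x a a' * z) (hdec.self_of_nhds b b' c c'))
  have E := congrArg₂ (· + ·) (congrArg₂ (· + ·) (hsum a a' b b' c c') (hsum b b' c c' a a'))
    (hsum c c' a a' b b')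
  simp only [Finset.mul_sum, ← Finset.sum_add_distrib] at E
  refine Eq.trans ?_ (E.trans (Finset.sum_congr rfl fun j _ => ?_))
  · have hs1 := hTs c a' a b
    have hs2 := hTs b b' a c
    simp only [hT] at k1 k2 hS hs1 hs2
    linear_combination -conj (σ.eps x b' c') * k1 - conj (σ.eps x c' a') * k2 - hS
      + conj (σ.eps x b' c') * hs1 + conj (σ.eps x c' a') * hs2
  -- Hessians of `p` and `q` drop out of the cyclic sum by symmetry.
  have hps := fun s s' t t' => del_twist00_symm hD h (hp j) s s' t t'
  have hqs := fun s s' t t' => del_twist00_symm hD h (hq j) s s' t t'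
  rw [hps b b' a a', hps c c' a a', hps c c' b b', hqs b b' a a', hqs c c' a a', hqs c c' b b',
    det₃]
  ring

variable {J : Type*} [Fintype J] {x : M}

/-- The Leibniz rule for a determinant of covector fields. -/
theorem mvfderiv_det₃ (nab : CovariantDerivative (𝓡 4) C2 S) {P p q : ∀ y : M, S y → S y → ℂ}
    (hP : FieldSmoothAt P x) (hp : FieldSmoothAt p x) (hq : FieldSmoothAt q x)
    (a a' b b' c c' : S x) (v : TangentSpace (𝓡 4) x) :
    FunDiffAt (fun y => det₃ (P y) (p y) (q y) (extend C2 a y) (extend C2 a' y) (extend C2 b y)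
        (extend C2 b' y) (extend C2 c y) (extend C2 c' y)) x ∧
    mvfderiv (𝓡 4) (fun y => det₃ (P y) (p y) (q y) (extend C2 a y) (extend C2 a' y)
        (extend C2 b y) (extend C2 b' y) (extend C2 c y) (extend C2 c' y)) x v
      = det₃ (fun s t => covDeriv nab P x s t v) (p x) (q x) a a' b b' c c'
        + det₃ (P x) (fun s t => covDeriv nab p x s t v) (q x) a a' b b' c c'
        + det₃ (P x) (p x) (fun s t => covDeriv nab q x s t v) a a' b b' c c'
        + det₃ (P x) (p x) (q x) (nab (extend C2 a) x v) a' b b' c c'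
        + det₃ (P x) (p x) (q x) a (nab (extend C2 a') x v) b b' c c'
        + det₃ (P x) (p x) (q x) a a' (nab (extend C2 b) x v) b' c c'
        + det₃ (P x) (p x) (q x) a a' b (nab (extend C2 b') x v) c c'
        + det₃ (P x) (p x) (q x) a a' b b' (nab (extend C2 c) x v) c'
        + det₃ (P x) (p x) (q x) a a' b b' c (nab (extend C2 c') x v) := by
  have P1 := hP.diffAt_extend a a'
  have P2 := hP.diffAt_extend b b'
  have P3 := hP.diffAt_extend c c'
  have p1 := hp.diffAt_extend a a'
  have p2 := hp.diffAt_extend b b'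
  have p3 := hp.diffAt_extend c c'
  have q1 := hq.diffAt_extend a a'
  have q2 := hq.diffAt_extend b b'
  have q3 := hq.diffAt_extend c c'
  have d1 := (p2.mul q3).sub (q2.mul p3)
  have d2 := (p3.mul q1).sub (q3.mul p1)
  have d3 := (p1.mul q2).sub (q1.mul p2)
  refine ⟨((P1.mul d1).add (P2.mul d2)).add (P3.mul d3), ?_⟩
  unfold det₃
  rw [mvfderiv_add_apply ((P1.mul d1).add (P2.mul d2)) (P3.mul d3),
    mvfderiv_add_apply (P1.mul d1) (P2.mul d2), mvfderiv_mul_apply P1 d1, mvfderiv_mul_apply P2 d2,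
    mvfderiv_mul_apply P3 d3, mvfderiv_sub_apply (p2.mul q3) (q2.mul p3),
    mvfderiv_sub_apply (p3.mul q1) (q3.mul p1), mvfderiv_sub_apply (p1.mul q2) (q1.mul p2),
    mvfderiv_mul_apply p2 q3, mvfderiv_mul_apply q2 p3, mvfderiv_mul_apply p3 q1,
    mvfderiv_mul_apply q3 p1, mvfderiv_mul_apply p1 q2, mvfderiv_mul_apply q1 p2]
  simp only [mvfderiv_extend nab, extend_apply_self]
  ring

/-- The covariant derivative of the duality between three-forms and covectors. -/
theorem del_dual (h : IsSpinConnection σ D nab) {β : ∀ y : M, S y → S y → ℂ}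
    {P p q : J → ∀ y : M, S y → S y → ℂ} (hβ : FieldSmoothAt β x)
    (hP : ∀ j, FieldSmoothAt (P j) x) (hp : ∀ j, FieldSmoothAt (p j) x)
    (hq : ∀ j, FieldSmoothAt (q j) x)
    (hdual : ∀ᶠ y in nhds x, ∀ a a' b b' c c' : S y,
      conj (σ.eps y b' c') * σ.eps y c a * β y b a' + conj (σ.eps y c' a') * σ.eps y c b * β y a b'
        = ∑ j, det₃ (P j y) (p j y) (q j y) a a' b b' c c')
    (d d' a a' b b' c c' : S x) :
    conj (σ.eps x b' c') * σ.eps x c a * σ.del nab β x d d' b a'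
        + conj (σ.eps x c' a') * σ.eps x c b * σ.del nab β x d d' a b'
      = ∑ j, (det₃ (σ.del nab (P j) x d d') (p j x) (q j x) a a' b b' c c'
        + det₃ (P j x) (σ.del nab (p j) x d d') (q j x) a a' b b' c c'
        + det₃ (P j x) (p j x) (σ.del nab (q j) x d d') a a' b b' c c') := by
  have key : ∀ v, conj (σ.eps x b' c') * σ.eps x c a * covDeriv nab β x b a' v
        + conj (σ.eps x c' a') * σ.eps x c b * covDeriv nab β x a b' v
      = ∑ j, (det₃ (fun s t => covDeriv nab (P j) x s t v) (p j x) (q j x) a a' b b' c c'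
        + det₃ (P j x) (fun s t => covDeriv nab (p j) x s t v) (q j x) a a' b b' c c'
        + det₃ (P j x) (p j x) (fun s t => covDeriv nab (q j) x s t v) a a' b b' c c') := by
    intro v
    have hE := fun s t : S x => (eps_smooth_extend (σ := σ) s t).diffAt
    have hB := fun s t : S x => hβ.diffAt_extend s t
    have hdet := fun j => mvfderiv_det₃ nab (hP j) (hp j) (hq j) a a' b b' c c' v
    have e : (fun y => conj (σ.eps y (extend C2 b' y) (extend C2 c' y))
          * σ.eps y (extend C2 c y) (extend C2 a y) * β y (extend C2 b y) (extend C2 a' y)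
        + conj (σ.eps y (extend C2 c' y) (extend C2 a' y))
          * σ.eps y (extend C2 c y) (extend C2 b y) * β y (extend C2 a y) (extend C2 b' y))
        =ᶠ[nhds x] fun y => ∑ j, det₃ (P j y) (p j y) (q j y) (extend C2 a y) (extend C2 a' y)
          (extend C2 b y) (extend C2 b' y) (extend C2 c y) (extend C2 c' y) := by
      filter_upwards [hdual] with y hy using hy _ _ _ _ _ _
    have e' := mvfderiv_congr e v
    rw [mvfderiv_add_apply (((hE b' c').conj.mul (hE c a)).mul (hB b a'))
        (((hE c' a').conj.mul (hE c b)).mul (hB a b')),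
      mvfderiv_mul₃_apply (hE b' c').conj (hE c a) (hB b a'),
      mvfderiv_mul₃_apply (hE c' a').conj (hE c b) (hB a b'),
      mvfderiv_conj_apply (hE b' c'), mvfderiv_conj_apply (hE c' a'),
      mvfderiv_sum_apply _ fun j _ => (hdet j).1] at e'
    simp only [(hdet _).2] at e'
    simp only [h.mvfderiv_eps, mvfderiv_extend nab, extend_apply_self, map_add] at e'
    -- Again the connection terms, now from six slots, cancel against the undifferentiated duality
    -- at `x`.
    have d := hdual.self_of_nhds
    have E := congrArg₂ (· - ·) (congrArg₂ (· - ·) (congrArg₂ (· - ·) (congrArg₂ (· - ·)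
      (congrArg₂ (· - ·) (congrArg₂ (· - ·) e' (d (nab (extend C2 a) x v) a' b b' c c'))
      (d a (nab (extend C2 a') x v) b b' c c')) (d a a' (nab (extend C2 b) x v) b' c c'))
      (d a a' b (nab (extend C2 b') x v) c c')) (d a a' b b' (nab (extend C2 c) x v) c'))
      (d a a' b b' c (nab (extend C2 c') x v))
    simp only [← Finset.sum_sub_distrib] at E
    exact Eq.trans (by ring) (E.trans (Finset.sum_congr rfl fun j _ => by ring))
  have E := congrArg₂ (· - ·) (key (σ.vecRe x d d'))
    (congrArg (fun z => Complex.I * z) (key (σ.vecRe x (Complex.I • d) d')))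
  simp only [Finset.mul_sum, ← Finset.sum_sub_distrib] at E
  exact Eq.trans (by simp only [del, spinorForm]; ring)
    (E.trans (Finset.sum_congr rfl fun j _ => by simp only [det₃, del, spinorForm]; ring))

/-- If `β` is the (twisted) divergence of a symmetric spinor field, its own (twisted) divergence
vanishes. -/
theorem div_twistedDiv (hD : D.torsion = 0) (h : IsSpinConnection σ D nab)
    {Θ U β : ∀ y : M, S y → S y → ℂ} {f p q : J → M → ℂ}
    (hΘ : IsSesquilinearField (RingHom.id ℂ) Θ) (hΘs : ∀ y, FieldSmoothAt Θ y)
    (hΘsymm : ∀ y a b, Θ y a b = Θ y b a) (hU : IsSesquilinearField (starRingEnd ℂ) U)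
    (hUs : ∀ y, FieldSmoothAt U y)
    (hUsymm : ∀ a a' b b' : S x, σ.del nab U x a a' b b' = σ.del nab U x b b' a a')
    (hβ : ∀ y a a', β y a a' = σ.twistedDiv nab U Θ y a a') (hβs : FieldSmoothAt β x)
    (hf : ∀ᶠ y in nhds x, ∀ j, FunSmoothAt (f j) y) (hp : ∀ᶠ y in nhds x, ∀ j, FunSmoothAt (p j) y)
    (hq : ∀ᶠ y in nhds x, ∀ j, FunSmoothAt (q j) y)
    (hdec : ∀ᶠ y in nhds x, ∀ b b' c c' : S y, Θ y b c * conj (σ.eps y b' c')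
      = ∑ j, (f j y * σ.twist00 (p j) y b b' * σ.twist00 (q j) y c c'
        - f j y * σ.twist00 (q j) y b b' * σ.twist00 (p j) y c c')) :
    σ.div11 nab β x = -σ.up x fun a b => σ.up x fun a' b' => U x b b' * β x a a' := by
  set P : J → ∀ y : M, S y → S y → ℂ := fun j y s t => σ.twist00 (f j) y s t + f j y * U y s t
    with hP
  -- The duality must hold near `x` because it is about to be differentiated.
  have hdual : ∀ᶠ y in nhds x, ∀ a a' b b' c c' : S y,
      conj (σ.eps y b' c') * σ.eps y c a * β y b a' + conj (σ.eps y c' a') * σ.eps y c b * β y a b'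
        = ∑ j, det₃ (P j y) (σ.twist00 (p j) y) (σ.twist00 (q j) y) a a' b b' c c' := by
    filter_upwards [hf, hp, hq, eventually_eventually_nhds.2 hdec] with y hfy hpy hqy hdy
    intro a a' b b' c c'
    rw [hβ, hβ]
    exact twistedDiv_dual hD h hΘ (hΘs y) hΘsymm hU hfy hpy hqy hdy a a' b b' c c'
  have hf := hf.self_of_nhds
  have hp := hp.self_of_nhds
  have hq := hq.self_of_nhds
  have hfs := fun j => σ.twist00_smooth (hf j)
  have hfU := fun j => FieldSmoothAt.smul (hf j) (hUs x)
  have hPd : ∀ j (a a' b b' : S x), σ.del nab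
      (fun y c d => σ.twist00 (f j) y c d + f j y * U y c d) x a a' b b'
      = σ.del nab (σ.twist00 (f j)) x a a' b b' + (σ.twist00 (f j) x a a' * U x b b'
        + f j x * σ.del nab U x a a' b b') := fun j a a' b b' => by
    rw [del_add (hfs j) (hfU j), del_smul (hf j) (hUs x)]
  have main := fun d d' a a' b b' c c' : S x => congrArg₂ (· + ·)
    (del_dual h hβs (fun j => (hfs j).add (hfU j)) (fun j => σ.twist00_smooth (hp j))
      (fun j => σ.twist00_smooth (hq j)) hdual d d' a a' b b' c c')
    (congrArg (fun z => U x d d' * z) (hdual.self_of_nhds a a' b b' c c'))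
  set o := σ.frameO x with ho
  set ι := σ.frameI x with hι
  have h0 : σ.eps x o ι = 1 := σ.eps_frame x
  have h1 : σ.eps x ι o = -1 := by rw [σ.eps_antisymm, h0]
  -- The alternating sum evaluates `d_U` of the three-form on the null tetrad `o ō, o ῑ, ι ō, ι ῑ`.
  -- Its left side is the twisted divergence of `β` up to sign.
  have E := congrArg₂ (· - ·) (congrArg₂ (· + ·) (congrArg₂ (· - ·)
    (main o o o ι ι o ι ι) (main o ι o o ι o ι ι)) (main ι o o o o ι ι ι)) (main ι ι o o o ι ι o)
  simp only [h0, h1, σ.eps_alt, map_one, map_neg, map_zero] at E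
  simp only [Finset.mul_sum, ← Finset.sum_add_distrib, ← Finset.sum_sub_distrib] at E
  have hfs' := fun j => del_twist00_symm hD h (hf j)
  have hps' := fun j => del_twist00_symm hD h (hp j)
  have hqs' := fun j => del_twist00_symm hD h (hq j)
  refine (fun hL => ?_) (E.trans (Finset.sum_eq_zero fun j _ => ?_))
  · simp only [div11, up, ← ho, ← hι]
    linear_combination -hL
  -- Each summand vanishes: Hessians are symmetric, `U` is closed, and in `d_U (df + f U)` the terms
  -- `df ∧ U` and `U ∧ df` cancel.
  · simp only [det₃]
    simp only [hPd, hP]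
    rw [hfs' j o ι o o, hfs' j ι o o o, hfs' j ι ι o o, hfs' j ι o o ι, hfs' j ι ι o ι,
      hfs' j ι ι ι o, hps' j o ι o o, hps' j ι o o o, hps' j ι ι o o, hps' j ι o o ι,
      hps' j ι ι o ι, hps' j ι ι ι o, hqs' j o ι o o, hqs' j ι o o o, hqs' j ι ι o o,
      hqs' j ι o o ι, hqs' j ι ι o ι, hqs' j ι ι ι o, hUsymm o ι o o, hUsymm ι o o o,
      hUsymm ι ι o o, hUsymm ι o o ι, hUsymm ι ι o ι, hUsymm ι ι ι o]
    ring

end SpinorStructure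

/-! ### Local coordinates and the decomposition of `Θ_{BC} ε̄_{B'C'}`. -/

/-- Near every point there are local coordinates `X j` with coordinate vector fields `E j`. -/
theorem exists_coordinates (x₀ : M) :
    ∃ (X : Fin 4 → M → ℂ) (E : Fin 4 → ∀ y : M, TangentSpace (𝓡 4) y), ∀ᶠ y in nhds x₀,
      (∀ j, FunSmoothAt (X j) y) ∧ (∀ j, VecSmoothAt (E j) y) ∧
      ∀ v : TangentSpace (𝓡 4) y, ∃ r : Fin 4 → ℝ,
        (∀ j, mvfderiv (𝓡 4) (X j) y v = r j) ∧ v = ∑ j, r j • E j y := by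
  set t := trivializationAt R4 (TangentSpace (𝓡 4) : M → Type _) x₀ with ht
  have hx₀ : x₀ ∈ t.baseSet := mem_baseSet_trivializationAt' x₀
  have hE : ∀ w : R4, ∀ᶠ y in nhds x₀, VecSmoothAt (fun y => t.symm y w) y := by
    intro w
    obtain ⟨s, hs, h⟩ := exists_contMDiffOn_extend (k := ∞) (𝓡 4) R4 (t.symm x₀ w)
    filter_upwards [eventually_mem_nhds_iff.2 hs] with y hy
    have := h.contMDiffAt hy
    simpa only [extend, ← ht, t.apply_mk_symm hx₀] using this
  refine ⟨fun j y => ((extChartAt (𝓡 4) x₀ y) j : ℂ),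
    fun j y => t.symm y (EuclideanSpace.basisFun (Fin 4) ℝ j), ?_⟩
  filter_upwards [Filter.eventually_all.2 fun j => hE (EuclideanSpace.basisFun (Fin 4) ℝ j),
    (chartAt R4 x₀).open_source.mem_nhds (mem_chart_source R4 x₀),
    t.open_baseSet.mem_nhds hx₀] with y hEy hy hyt
  have hc : ContMDiffAt (𝓡 4) 𝓘(ℝ, R4) ∞ (extChartAt (𝓡 4) x₀) y := contMDiffAt_extChartAt' hy
  set L : Fin 4 → R4 →L[ℝ] ℂ := fun j =>
    Complex.ofRealCLM ∘L (EuclideanSpace.proj j : R4 →L[ℝ] ℝ) with hL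
  refine ⟨fun j => ContMDiffAt.comp (I' := 𝓘(ℝ, R4)) y (g := fun w : R4 => ((w j : ℝ) : ℂ))
    (L j).contDiff.contDiffAt.contMDiffAt hc, hEy,
    fun v => ?_⟩
  -- The tangent trivialization at `x₀` is the derivative of the chart, which makes the frame `E`
  -- dual to the differentials of the coordinates.
  have hm := TangentBundle.continuousLinearMapAt_trivializationAt (I := 𝓡 4) hy
  set w : R4 := t.continuousLinearMapAt ℝ y v with hw
  refine ⟨fun j => w j, fun j => ?_, ?_⟩
  · have hd := (hc.mdifferentiableAt (by simp)).hasMFDerivAt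
    have hcomp := ((L j).hasMFDerivAt (x := extChartAt (𝓡 4) x₀ y)).comp y hd
    have : mfderiv (𝓡 4) 𝓘(ℝ, ℂ) (fun y => ((extChartAt (𝓡 4) x₀ y) j : ℂ)) y = _ := hcomp.mfderiv
    have hw' : w = mfderiv (𝓡 4) 𝓘(ℝ, R4) (extChartAt (𝓡 4) x₀) y v := by
      rw [hw]; exact congrArg (fun l => l v) hm
    rw [hw']
    simp only [mvfderiv, this]
    rfl
  · have hv : v = t.symmL ℝ y w := by rw [hw, t.symmL_continuousLinearMapAt hyt]
    have hw' : w = ∑ j, w j • EuclideanSpace.basisFun (Fin 4) ℝ j := by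
      simpa using ((EuclideanSpace.basisFun (Fin 4) ℝ).sum_repr w).symm
    rw [hv]
    conv_lhs => rw [hw', map_sum]
    exact Finset.sum_congr rfl fun j _ => (map_smul (t.symmL ℝ y) (w j) _).trans
      (congrArg _ (t.symmL_apply hyt _))

/-- Expands the wedge of two covectors in coordinate differentials. Summing over all ordered pairs
lets the sums factor, with no antisymmetry of the coefficients required. -/
theorem sum_wedge (a b X Y : Fin 4 → ℂ) :
    ∑ j : Fin 4 × Fin 4, (a j.1 * b j.2 * X j.1 * Y j.2 - a j.1 * b j.2 * X j.2 * Y j.1)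
      = (∑ j, X j * a j) * (∑ j, Y j * b j) - (∑ j, X j * b j) * (∑ j, Y j * a j) := by
  rw [Finset.sum_sub_distrib, Finset.sum_mul_sum, Finset.sum_mul_sum, Fintype.sum_prod_type,
    Fintype.sum_prod_type, Finset.sum_comm (f := fun j k => X j * b j * (Y k * a k))]
  congr 1 <;> exact Finset.sum_congr rfl fun j _ => Finset.sum_congr rfl fun k _ => by ring

namespace SpinorStructure

/-- Locally `Θ_{BC} ε̄_{B'C'}` is a combination of wedge products of gradients. -/
theorem exists_decomp {Θ : ∀ y : M, S y → S y → ℂ}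
    (hΘ : IsSesquilinearField (RingHom.id ℂ) Θ) (hΘs : ∀ y, FieldSmoothAt Θ y)
    (hΘsymm : ∀ y a b, Θ y a b = Θ y b a) (x₀ : M) :
    ∃ f p q : Fin 4 × Fin 4 → M → ℂ,
      (∀ᶠ y in nhds x₀, ∀ j, FunSmoothAt (f j) y) ∧ (∀ᶠ y in nhds x₀, ∀ j, FunSmoothAt (p j) y) ∧
      (∀ᶠ y in nhds x₀, ∀ j, FunSmoothAt (q j) y) ∧
      ∀ᶠ y in nhds x₀, ∀ b b' c c' : S y, Θ y b c * conj (σ.eps y b' c')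
        = ∑ j, (f j y * σ.twist00 (p j) y b b' * σ.twist00 (q j) y c c'
          - f j y * σ.twist00 (q j) y b b' * σ.twist00 (p j) y c c') := by
  obtain ⟨X, E, hXE⟩ := exists_coordinates x₀
  set o : ∀ y, S y := extend C2 (σ.frameO x₀) with ho
  set ι : ∀ y, S y := extend C2 (σ.frameI x₀) with hι
  set e : M → ℂ := fun y => σ.eps y (o y) (ι y) with he
  set A : Fin 4 → (∀ y, S y) → (∀ y, S y) → M → ℂ := fun j s t y =>
    spinorForm (fun u w => σ.vecRe y u w) (fun v => (g.val y (E j y) v : ℂ)) (s y) (t y) with hA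
  have hos := eventually_spinSmoothAt_extend (σ.frameO x₀)
  have hιs := eventually_spinSmoothAt_extend (σ.frameI x₀)
  have hes : FunSmoothAt e x₀ := eps_smooth_extend _ _
  -- The extended frame is a spin frame at `x₀`, but nearby it is only known that `e ≠ 0`.
  have he0 : ∀ᶠ y in nhds x₀, e y ≠ 0 :=
    (ContMDiffAt.continuousAt hes).eventually_ne (by simp [he, ho, hι, σ.eps_frame])
  have hAs : ∀ j s t y, VecSmoothAt (E j) y → SpinSmoothAt s y → SpinSmoothAt t y →
      FunSmoothAt (A j s t) y := by
    intro j s t y hEy hs ht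
    have hr : ∀ s : ∀ y, S y, SpinSmoothAt s y →
        FunSmoothAt (fun y => (g.val y (E j y) (σ.vecRe y (s y) (t y)) : ℂ)) y := fun s hs =>
      ContMDiffAt.comp y (g := Complex.ofRealCLM) Complex.ofRealCLM.contDiff.contDiffAt.contMDiffAt
        (g.smooth y _ _ hEy (σ.vecRe_smooth y s t hs ht))
    exact (hr s hs).sub ((funSmoothAt_const _).mul (hr _ hs.smul_I))
  -- The covector `g(·, s t̄)` has coordinate components `g(E j, s t̄)`, and `g = ε ε̄` factors it.
  have key : ∀ᶠ y in nhds x₀, ∀ (s t : ∀ y, S y) (b b' : S y),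
      ∑ j, σ.twist00 (X j) y b b' * A j s t y = σ.eps y b (s y) * conj (σ.eps y b' (t y)) := by
    filter_upwards [hXE] with y hy s t b b'
    have hv : ∀ v, spinorForm (fun u w => σ.vecRe y u w) (fun v' => (g.val y v v' : ℂ)) (s y) (t y)
        = ∑ j, mvfderiv (𝓡 4) (X j) y v * A j s t y := by
      intro v
      obtain ⟨r, hr, hvr⟩ := hy.2.2 v
      simp only [hr, hA, spinorForm]
      rw [hvr]
      simp only [map_sum, LinearMap.sum_apply, map_smul, LinearMap.smul_apply, smul_eq_mul,
        Complex.ofReal_sum, Complex.ofReal_mul, Finset.mul_sum]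
      rw [← Finset.sum_sub_distrib]
      exact Finset.sum_congr rfl fun j _ => by ring
    rw [← σ.metric_eq y b b' (s y) (t y)]
    simp only [hv]
    simp only [spinorForm, twist00, Finset.mul_sum, ← Finset.sum_sub_distrib]
    exact Finset.sum_congr rfl fun j _ => by ring
  -- The frame components of `Θ` multiply the basic two-forms of type `Θ_{BC} ε̄_{B'C'}` built from
  -- the tetrad. Expanding the two unprimed indices costs `e²`, and the primed pair costs `ē`.
  refine ⟨fun j y => (e y * e y * conj (e y))⁻¹ * (Θ y (o y) (o y) * (A j.1 ι o y * A j.2 ι ι y)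
      - Θ y (o y) (ι y) * (A j.1 ι o y * A j.2 o ι y + A j.1 o o y * A j.2 ι ι y)
      + Θ y (ι y) (ι y) * (A j.1 o o y * A j.2 o ι y)), fun j => X j.1, fun j => X j.2,
    ?_, ?_, ?_, ?_⟩
  · filter_upwards [hXE, hos, hιs, he0] with y hy ho hι he0 j
    have he : FunSmoothAt e y := σ.eps_smooth y _ _ ho hι
    have hA := fun j s t => hAs j s t y (hy.2.1 j)
    exact (((he.mul he).mul he.conj).inv (by simpa using he0)).mul
      ((((hΘs y _ _ ho ho).mul ((hA _ _ _ hι ho).mul (hA _ _ _ hι hι))).sub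
        ((hΘs y _ _ ho hι).mul (((hA _ _ _ hι ho).mul (hA _ _ _ ho hι)).add
          ((hA _ _ _ ho ho).mul (hA _ _ _ hι hι))))).add
        ((hΘs y _ _ hι hι).mul ((hA _ _ _ ho ho).mul (hA _ _ _ ho hι))))
  · filter_upwards [hXE] with y hy j using hy.1 j.1
  · filter_upwards [hXE] with y hy j using hy.1 j.2
  · filter_upwards [key, he0] with y hy he0 b b' c c'
    have w := fun s t s' t' => sum_wedge (fun j => A j s t y) (fun j => A j s' t' y)
      (fun j => σ.twist00 (X j) y b b') (fun j => σ.twist00 (X j) y c c')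
    simp only [hy] at w
    have hsum := congrArg₂ (· + ·) (congrArg₂ (· - ·)
      (congrArg (fun z => Θ y (o y) (o y) * z) (w ι o ι ι))
      (congrArg (fun z => Θ y (o y) (ι y) * z)
        (congrArg₂ (· + ·) (w ι o o ι) (w o o ι ι))))
      (congrArg (fun z => Θ y (ι y) (ι y) * z) (w o o o ι))
    simp only [Finset.mul_sum, ← Finset.sum_add_distrib, ← Finset.sum_sub_distrib] at hsum
    have hne : e y * e y * conj (e y) ≠ 0 := by simpa using he0
    have hsum' := congrArg (fun z => (e y * e y * conj (e y))⁻¹ * z) hsum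
    simp only [Finset.mul_sum] at hsum'
    refine Eq.trans ?_ (hsum'.symm.trans (Finset.sum_congr rfl fun j _ => by ring))
    rw [eq_inv_mul_iff_mul_eq₀ hne]
    -- `k1` expands `b` in the frame, `k2` and `k3` expand `c`, and `k4` turns the primed
    -- determinant into `ε̄(b', c')`.
    have k1 := σ.schouten (hΘ.left y c) b (o y) (ι y)
    have k2 := σ.schouten (hΘ.right y (o y)) c (o y) (ι y)
    have k3 := σ.schouten (hΘ.right y (ι y)) c (o y) (ι y)
    have k4 := σ.schouten (τ := starRingEnd ℂ) (h := fun s => conj (σ.eps y s c'))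
      ⟨fun s t => by simp, fun z s => by simp⟩ b' (o y) (ι y)
    simp only [RingHom.id_apply, σ.eps_antisymm y (ι y) b, σ.eps_antisymm y (ι y) c,
      σ.eps_antisymm y (ι y) b', σ.eps_antisymm y (ι y) c', σ.eps_antisymm y (o y) c', map_neg,
      hΘsymm y (ι y) (o y)] at k1 k2 k3 k4
    set Q := σ.eps y b (ι y) * (σ.eps y c (ι y) * Θ y (o y) (o y)
        - σ.eps y c (o y) * Θ y (o y) (ι y))
      - σ.eps y b (o y) * (σ.eps y c (ι y) * Θ y (o y) (ι y)
        - σ.eps y c (o y) * Θ y (ι y) (ι y)) with hQ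
    simp only [he]
    linear_combination (σ.eps y (o y) (ι y) * conj (σ.eps y (o y) (ι y))
        * conj (σ.eps y b' c')) * k1
      + conj (σ.eps y (o y) (ι y)) * conj (σ.eps y b' c') * (σ.eps y b (ι y) * k2
        - σ.eps y b (o y) * k3) + Q * k4

end SpinorStructure

end Fields

end KillingSpinorMaxwell

end

theorem mainTheorem6 {M : Type*} [TopologicalSpace M] [ChartedSpace KillingSpinorMaxwell.R4 M]
    [IsManifold (𝓡 4) ∞ M]
    {S : M → Type*} [TopologicalSpace (TotalSpace KillingSpinorMaxwell.C2 S)]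
    [∀ x, AddCommGroup (S x)] [∀ x, Module ℂ (S x)] [∀ x, TopologicalSpace (S x)]
    [∀ x, IsTopologicalAddGroup (S x)] [∀ x, ContinuousSMul ℝ (S x)]
    [FiberBundle KillingSpinorMaxwell.C2 S] [VectorBundle ℂ KillingSpinorMaxwell.C2 S]
    [VectorBundle ℝ KillingSpinorMaxwell.C2 S]
    [ContMDiffVectorBundle ∞ KillingSpinorMaxwell.C2 S (𝓡 4)]
    (g : KillingSpinorMaxwell.LorentzMetric M)
    (σ : KillingSpinorMaxwell.SpinorStructure g S)
    (D : CovariantDerivative (𝓡 4) KillingSpinorMaxwell.R4 (TangentSpace (𝓡 4) : M → Type _))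
    (hD : KillingSpinorMaxwell.IsLeviCivita g D)
    (nab : CovariantDerivative (𝓡 4) KillingSpinorMaxwell.C2 S)
    (hnab : KillingSpinorMaxwell.IsSpinConnection σ D nab)
    (κ φ : KillingSpinorMaxwell.SymSpinor S)
    (hκ : σ.IsKillingSpinor nab κ)
    (hκ0 : ∀ x, σ.inner20 κ.comp κ.comp x ≠ 0)
    (hφ : σ.IsMaxwell nab φ) :
    (∀ (x : M) (a a' : S x),
      σ.beta nab κ φ x a a'
        = -σ.U κ x a a' * σ.Upsilon κ φ x + σ.twist00 (σ.Upsilon κ φ) x a a') ∧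
    (∀ x : M,
      σ.div11 nab (σ.beta nab κ φ) x
        = -σ.up x fun a b => σ.up x fun a' b' => σ.U κ x b b' * σ.beta nab κ φ x a a') ∧
    (∀ (x : M) (a b : S x),
      σ.curl11 nab (σ.beta nab κ φ) x a b
        = (1 / 2) * ((σ.up x fun a' b' => σ.U κ x a b' * σ.beta nab κ φ x b a')
          + σ.up x fun a' b' => σ.U κ x b b' * σ.beta nab κ φ x a a')) ∧
    (∀ (x : M) (a' b' : S x),
      σ.curlDagger11 nab (σ.beta nab κ φ) x a' b'
        = (1 / 2) * ((σ.up x fun a b => σ.U κ x b a' * σ.beta nab κ φ x a b')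
          + σ.up x fun a b => σ.U κ x b b' * σ.beta nab κ φ x a a')) := by
  refine ⟨fun x a a' => KillingSpinorMaxwell.SpinorStructure.beta_eq hnab hκ hκ0 hφ x a a',
    fun x => ?_,
    fun x a b => KillingSpinorMaxwell.SpinorStructure.curl11_beta hD.torsion_free hnab hκ hκ0 hφ
      x a b,
    fun x a' b' => KillingSpinorMaxwell.SpinorStructure.curlDagger11_beta hD.torsion_free hnab hκ
      hκ0 hφ x a' b'⟩
  have hΘs := KillingSpinorMaxwell.SpinorStructure.Theta_smooth (σ := σ) κ φ
  have hΘ := KillingSpinorMaxwell.SpinorStructure.Theta_isSesquilinearField (σ := σ) κ φ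
  have hΘsymm := KillingSpinorMaxwell.SpinorStructure.Theta_symm (σ := σ) κ φ
  -- The divergence equation is local, so a decomposition near the given point is enough.
  obtain ⟨f, p, q, hf, hp, hq, hdec⟩ :=
    KillingSpinorMaxwell.SpinorStructure.exists_decomp hΘ hΘs hΘsymm x
  refine KillingSpinorMaxwell.SpinorStructure.div_twistedDiv hD.torsion_free hnab hΘ hΘs hΘsymm
    (KillingSpinorMaxwell.SpinorStructure.U_isSesquilinearField κ)
    (fun y => KillingSpinorMaxwell.SpinorStructure.U_smooth hκ0 y)
    (KillingSpinorMaxwell.SpinorStructure.del_U_symm hD.torsion_free hnab hκ0 x)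
    (fun y a a' => ?_) (KillingSpinorMaxwell.SpinorStructure.beta_smooth hnab hκ hκ0 hφ x)
    hf hp hq hdec
  simp only [KillingSpinorMaxwell.SpinorStructure.beta,
    KillingSpinorMaxwell.SpinorStructure.curlDagger20,
    KillingSpinorMaxwell.SpinorStructure.twistedDiv, KillingSpinorMaxwell.SpinorStructure.up]
  ring
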